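/- Let $T>0$, $q\le p$, $m$ be natural numbers ($T$ real), let $G_1(s)$ be a $q\times p$ matrix and $G_2(s)$ a $q\times m$ matrix of real rational functions, let $D(s)$ be a vector of $m$ real rational functions, and consider the system $$Y_k(s)=G_1(s)U_k(s)+G_2(s)D(s),\qquad k=0,1,2,\dots,$$ on the time interval $[0,T]$, where $U_k=\mathcal L[u_k]$ and $Y_k=\mathcal L[y_k]$ are the Laplace transforms of the inputs $u_k(t)\in\mathbb R^p$ and of the (continuous) outputs $y_k(t)\in\mathbb R^q$. Signals are functions on $[0,\infty)$ with an absolutely convergent Laplace transform, and identities between Laplace transforms are meant on some right half-plane. Assume C1) $G_1$ and $G_2$ are strictly proper, i.e. tend to $0$ as $s\to\infty$; C2) $D(s)=d_0+\widehat D(s)$ with a nonzero vector $d_0\in\mathbb R^m$ and a strictly proper rational vector $\widehat D$; C3) $G_1$ has relative degree one, i.e. $\lim_{s\to\infty}sG_1(s)$ exists and has full rank; C4) with $\Phi_1=\mathcal L^{-1}[G_1]$ (continuous on $[0,\infty)$), the matrix $\Phi_{1,1}(0)$ formed by the first $q$ columns of $\Phi_1(0)$ is nonsingular. Write $G_1=[G_{11}\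 \ G_{12}]$ with $G_{11}$ of size $q\times q$ and $G_{12}$ of size $q\times(p-q)$. Let $y_d\in C^1([0,T],\mathbb R^q)$. A continuation of $y_d$ is a signal $\tilde y$ on $[0,\infty)$ that agrees with $y_d$ on $[0,T]$ and has a Laplace transform; put $Y_d=\mathcal L[\tilde y]$. The trajectory $y_d$ is called trackable if, for some continuation, there is an input $u_d$ whose Laplace transform $U_d=\mathcal L[u_d]$ satisfies $$G_1(s)U_d(s)=Y_d(s)-G_2(s)D(s).\qquad(*)$$ Then: 1. $y_d$ is trackable if and only if $y_d(0)=y_k(0)$ for all $k$. Moreover, for every continuation $\tilde y$ that is $C^1$ on $[0,\infty)$ and whose derivative has a Laplace transform, $(*)$ has a solution $U_d=\mathcal L[u_d]$ if and only if $y_d(0)=y_k(0)$ for all $k$. 2. $G_{11}$ is nonsingular, and for every continuation for which $(*)$ is solvable, the set of all solutions $U_d=\mathcal L[u_d]$ of $(*)$ is $$\mathcal U_d=\left\{\begin{bmatrix}G_{11}^{-1}(s)\,[Y_d(s)-G_2(s)D(s)]\\0\end{bmatrix}+\begin{bmatrix}-G_{11}^{-1}(s)G_{12}(s)\\I\end{bmatrix}U_{d,2}(s)\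 :\ U_{d,2}=\mathcal L[u_{d,2}],\ u_{d,2}(t)\in\mathbb R^{p-q}\right\},$$ where $u_{d,2}$ ranges over all signals with values in $\mathbb R^{p-q}$. 3. For every continuation, and for $u_d$ and $u_{d,2}$ related by this formula, $u_d$ is continuous on $[0,T]$ if and only if $u_{d,2}$ is continuous on $[0,T]$ (continuity being understood up to changing the signals on a null set). -/

import Mathlib

open Filter Topology Set MeasureTheory

namespace ILC

noncomputable section

/-! ### Signals and their Laplace transforms

A signal is a function of time `t`, of which only the values for `t ≥ 0` matter. -/

/-- A scalar signal has a Laplace transform: `e^{-σ t} f(t)` is integrable on `(0, ∞)` for some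
real `σ`, so that the Laplace integral converges absolutely on the half-plane `Re s ≥ σ`. -/
def LaplaceTransformable (f : ℝ → ℝ) : Prop :=
  ∃ σ : ℝ, IntegrableOn (fun t : ℝ => Real.exp (-σ * t) * f t) (Ioi 0)

/-- The Laplace transform `ℒ[f](s) = ∫₀^∞ e^{-s t} f(t) dt`. -/
def laplace (f : ℝ → ℝ) (s : ℂ) : ℂ :=
  ∫ t in Ioi (0 : ℝ), Complex.exp (-s * (t : ℂ)) * ((f t : ℝ) : ℂ)

/-- A vector signal has a Laplace transform. -/
def LaplaceTransformableVec {n : ℕ} (f : ℝ → Fin n → ℝ) : Prop :=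
  ∀ i, LaplaceTransformable fun t => f t i

/-- The (entrywise) Laplace transform of a vector signal. -/
def laplaceVec {n : ℕ} (f : ℝ → Fin n → ℝ) (s : ℂ) : Fin n → ℂ :=
  fun i => laplace (fun t => f t i) s

/-- "For all `s` with sufficiently large real part". Identities between Laplace transforms are
identities on some right half-plane. -/
def rightHalfPlanes : Filter ℂ := comap Complex.re atTop

/-! ### Rational matrices -/

/-- The value `G(s)` of a real rational matrix at a complex number `s`. -/
def evalMat {a b : ℕ} (G : Matrix (Fin a) (Fin b) (RatFunc ℝ)) (s : ℂ) :
    Matrix (Fin a) (Fin b) ℂ :=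
  G.map fun g => RatFunc.eval (algebraMap ℝ ℂ) s g

/-- The value `D(s)` of a real rational vector at a complex number `s`. -/
def evalVec {a : ℕ} (D : Fin a → RatFunc ℝ) (s : ℂ) : Fin a → ℂ :=
  fun i => RatFunc.eval (algebraMap ℝ ℂ) s (D i)

/-- `G` is strictly proper: `lim_{s → ∞} G(s) = 0`. -/
def StrictlyProper {a b : ℕ} (G : Matrix (Fin a) (Fin b) (RatFunc ℝ)) : Prop :=
  Tendsto (evalMat G) (Bornology.cobounded ℂ) (𝓝 0)

/-- A rational vector `D` is strictly proper: `lim_{s → ∞} D(s) = 0`. -/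
def StrictlyProperVec {a : ℕ} (D : Fin a → RatFunc ℝ) : Prop :=
  Tendsto (evalVec D) (Bornology.cobounded ℂ) (𝓝 0)

/-- `G` has relative degree one: `s G(s)` has a limit as `s → ∞`, and this (real) limit matrix has
full rank. -/
def RelativeDegreeOne {a b : ℕ} (G : Matrix (Fin a) (Fin b) (RatFunc ℝ)) : Prop :=
  ∃ M : Matrix (Fin a) (Fin b) ℝ,
    Tendsto (fun s : ℂ => s • evalMat G s) (Bornology.cobounded ℂ)
      (𝓝 (M.map fun x : ℝ => (x : ℂ))) ∧
    M.rank = min a b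

/-- `Φ = ℒ⁻¹[G]` on `[0, ∞)`: `Φ` is the (unique) continuous matrix function on `[0, ∞)` whose
Laplace transform is the rational matrix `G`. -/
def IsInverseLaplace {a b : ℕ} (Φ : ℝ → Matrix (Fin a) (Fin b) ℝ)
    (G : Matrix (Fin a) (Fin b) (RatFunc ℝ)) : Prop :=
  ContinuousOn Φ (Ici 0) ∧
  (∀ i j, LaplaceTransformable fun t => Φ t i j) ∧
  ∀ i j, ∀ᶠ s in rightHalfPlanes, laplace (fun t => Φ t i j) s = evalMat G s i j

/-! ### Blocks -/

/-- The first `q` columns of a matrix with `p ≥ q` columns. -/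
def leftBlock {R : Type*} {q p : ℕ} (h : q ≤ p) (M : Matrix (Fin q) (Fin p) R) :
    Matrix (Fin q) (Fin q) R :=
  M.submatrix id (Fin.castLE h)

/-- The last `p - q` columns of a matrix with `p ≥ q` columns. -/
def rightBlock {R : Type*} {q p : ℕ} (h : q ≤ p) (M : Matrix (Fin q) (Fin p) R) :
    Matrix (Fin q) (Fin (p - q)) R :=
  M.submatrix id fun j => Fin.cast (Nat.add_sub_cancel' h) (Fin.natAdd q j)

/-- The column vector of length `p` with upper block `v` and lower block `w`. -/
def stack {R : Type*} {q p : ℕ} (h : q ≤ p) (v : Fin q → R) (w : Fin (p - q) → R) : Fin p → R :=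
  fun j => Fin.append v w (Fin.cast (Nat.add_sub_cancel' h).symm j)

/-! ### The system and trackability -/

/-- `u` and `y` are an input and an output of the system `Y(s) = G₁(s) U(s) + G₂(s) D(s)` running
on `[0, T]`. The output of the system is a continuous function, and the requirement on continuity
selects the continuous representative of `ℒ⁻¹[Y]`, so that `y 0` makes sense. -/
def IsSystemRun {q p m : ℕ} (T : ℝ) (G₁ : Matrix (Fin q) (Fin p) (RatFunc ℝ))
    (G₂ : Matrix (Fin q) (Fin m) (RatFunc ℝ)) (D : Fin m → RatFunc ℝ)
    (u : ℝ → Fin p → ℝ) (y : ℝ → Fin q → ℝ) : Prop :=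
  LaplaceTransformableVec u ∧ LaplaceTransformableVec y ∧ ContinuousOn y (Icc 0 T) ∧
  ∀ᶠ s in rightHalfPlanes,
    laplaceVec y s = (evalMat G₁ s).mulVec (laplaceVec u s) + (evalMat G₂ s).mulVec (evalVec D s)

/-- `u` solves the algebraic equation `G₁(s) U(s) = Y(s) - G₂(s) D(s)`, where `U = ℒ[u]` and
`Y = ℒ[y]`. -/
def IsDesiredInput {q p m : ℕ} (G₁ : Matrix (Fin q) (Fin p) (RatFunc ℝ))
    (G₂ : Matrix (Fin q) (Fin m) (RatFunc ℝ)) (D : Fin m → RatFunc ℝ)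
    (y : ℝ → Fin q → ℝ) (u : ℝ → Fin p → ℝ) : Prop :=
  LaplaceTransformableVec u ∧
  ∀ᶠ s in rightHalfPlanes,
    (evalMat G₁ s).mulVec (laplaceVec u s) = laplaceVec y s - (evalMat G₂ s).mulVec (evalVec D s)

/-- `y` continues the trajectory `yd`, given on `[0, T]`, to a signal on `[0, ∞)` that has a
Laplace transform. -/
def IsContinuation {q : ℕ} (T : ℝ) (yd y : ℝ → Fin q → ℝ) : Prop :=
  LaplaceTransformableVec y ∧ EqOn y yd (Icc 0 T)

/-- A continuation that is continuously differentiable on `[0, ∞)` and whose derivative has a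
Laplace transform, too. -/
def IsRegularContinuation {q : ℕ} (T : ℝ) (yd y : ℝ → Fin q → ℝ) : Prop :=
  IsContinuation T yd y ∧ ContDiffOn ℝ 1 y (Ici 0) ∧
  LaplaceTransformableVec (derivWithin y (Ici 0))

/-- The trajectory `yd`, given on `[0, T]` (values outside `[0, T]` are irrelevant), is trackable:
some input solves the algebraic equation. The Laplace transform of `yd` is that of a continuation
of `yd` to `[0, ∞)`, since the system is only concerned with the time interval `[0, T]`. -/
def Trackable {q p m : ℕ} (T : ℝ) (G₁ : Matrix (Fin q) (Fin p) (RatFunc ℝ))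
    (G₂ : Matrix (Fin q) (Fin m) (RatFunc ℝ)) (D : Fin m → RatFunc ℝ)
    (yd : ℝ → Fin q → ℝ) : Prop :=
  ∃ y, IsContinuation T yd y ∧ ∃ u, IsDesiredInput G₁ G₂ D y u

/-- The set of the solutions `U` to `G₁ U = Y - G₂ D`, with `Y = ℒ[y]`, among the Laplace
transforms of inputs. All functions of `s` are considered on right half-planes only. -/
def desiredInputTransforms {q p m : ℕ} (G₁ : Matrix (Fin q) (Fin p) (RatFunc ℝ))
    (G₂ : Matrix (Fin q) (Fin m) (RatFunc ℝ)) (D : Fin m → RatFunc ℝ)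
    (y : ℝ → Fin q → ℝ) : Set (ℂ → Fin p → ℂ) :=
  {U | (∃ u : ℝ → Fin p → ℝ, LaplaceTransformableVec u ∧ U =ᶠ[rightHalfPlanes] laplaceVec u) ∧
    ∀ᶠ s in rightHalfPlanes,
      (evalMat G₁ s).mulVec (U s) = laplaceVec y s - (evalMat G₂ s).mulVec (evalVec D s)}

/-- The function of `s`
`[G₁₁⁻¹ (Y - G₂ D); 0] + [-G₁₁⁻¹ G₁₂; I] U₂`, where `G₁ = [G₁₁ G₁₂]`, `Y = ℒ[y]`, `U₂ = ℒ[u₂]`. -/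
def inputFormula {q p m : ℕ} (h : q ≤ p) (G₁ : Matrix (Fin q) (Fin p) (RatFunc ℝ))
    (G₂ : Matrix (Fin q) (Fin m) (RatFunc ℝ)) (D : Fin m → RatFunc ℝ)
    (y : ℝ → Fin q → ℝ) (u₂ : ℝ → Fin (p - q) → ℝ) (s : ℂ) : Fin p → ℂ :=
  stack h ((evalMat (leftBlock h G₁)⁻¹ s).mulVec
      (laplaceVec y s - (evalMat G₂ s).mulVec (evalVec D s))) 0 +
  stack h ((evalMat (-((leftBlock h G₁)⁻¹ * rightBlock h G₁)) s).mulVec (laplaceVec u₂ s))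
    (laplaceVec u₂ s)

/-- `f ∈ C[0, T]`. A signal is determined by its Laplace transform only up to null sets, so this
says that `f` agrees almost everywhere on `[0, T]` with a function continuous on `[0, T]`. -/
def IsContinuousSignal {n : ℕ} (T : ℝ) (f : ℝ → Fin n → ℝ) : Prop :=
  ∃ g : ℝ → Fin n → ℝ, ContinuousOn g (Icc 0 T) ∧ f =ᵐ[volume.restrict (Icc 0 T)] g

end

end ILC

open ILC

namespace ILC

/-! The key fact is `exists_inverseLaplace`: a rational function that vanishes at infinity has an
expansion `∑ bₙ s⁻ⁿ⁻¹` with geometrically bounded coefficients, so it is the transform of the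
continuous function `∑ bₙ tⁿ / n!`. Consequently a rational matrix with a finite limit `A₀` at
infinity acts on signals as `u ↦ A₀ u + κ * u` with a continuous kernel
(`LimitAtInfinity.exists_convOp`). Such an operator is causal and preserves continuity on `[0, T]`.
If `A₀ = 0`, it even sends every transformable signal to a continuous one vanishing at `0`.

Necessity of the initial condition: `G₁` has no feedthrough, so every continuous output starts at `ψ
0`, where `ψ` is the inverse transform of `G₂ D`. A trajectory that is tracked is itself an output,
so it starts there too.

Sufficiency: by the initial value theorem `s G₁₁(s)` tends to the nonsingular matrix `Φ₁,₁(0)`.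
Hence `G₁₁` is invertible and `G₁₁⁻¹ = (s G₁₁)⁻¹ s` is a proper operator after one differentiation.
If `y` is `C¹` and `y(0) = ψ(0)`, the initial values cancel and `s (Y - G₂ D)` is the transform of
`y' - ψ'`, so the inverse can be applied.

Solution set: this is block elimination. The coefficient `G₁₁⁻¹ G₁₂ = (s G₁₁)⁻¹ (s G₁₂)` of the free
block is proper, so any transformable `u_{d,2}` may be inserted.

Continuity: the upper block is a convolution operator applied to `u_{d,2}` plus a signal with
transform `G₁₁⁻¹ (Y - G₂ D)`. The latter is continuous for a regular continuation; by causality of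
the inverse, another continuation changes it only on a null subset of `[0, T]`. Lerch's theorem
passes from transforms back to signals throughout. -/

theorem eventually_rightHalfPlanes {P : ℂ → Prop} :
    (∀ᶠ s in rightHalfPlanes, P s) ↔ ∃ σ : ℝ, ∀ s : ℂ, σ ≤ s.re → P s := by
  rw [rightHalfPlanes, eventually_comap, eventually_atTop]
  constructor
  · rintro ⟨σ, h⟩
    exact ⟨σ, fun s hs => h s.re hs s rfl⟩
  · rintro ⟨σ, h⟩
    exact ⟨σ, fun b hb s hs => h s (hs ▸ hb)⟩

/-- Transfers facts about rational functions near infinity to right half-planes, since `Re s ≤ ‖s‖`.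
-/
theorem rightHalfPlanes_le_cobounded : rightHalfPlanes ≤ Bornology.cobounded ℂ := by
  rw [← comap_norm_atTop]
  intro P hP
  rw [mem_comap] at hP
  obtain ⟨t, ht, htP⟩ := hP
  obtain ⟨a, ha⟩ := mem_atTop_sets.1 ht
  refine eventually_rightHalfPlanes.2 ⟨a, fun s hs => htP (ha _ (hs.trans (Complex.re_le_norm s)))⟩

/-! ### Calculus of scalar Laplace transforms -/

theorem LaplaceTransformable.exists_integrableOn {f : ℝ → ℝ} (hf : LaplaceTransformable f) :
    ∃ σ : ℝ, ∀ s : ℂ, σ ≤ s.re →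
      IntegrableOn (fun t : ℝ => Complex.exp (-s * (t : ℂ)) * ((f t : ℝ) : ℂ)) (Ioi 0) := by
  obtain ⟨σ, hσ⟩ := hf
  refine ⟨σ, fun s hs => ?_⟩
  have h1 : IntegrableOn (fun t : ℝ => ((Real.exp (-σ * t) * f t : ℝ) : ℂ)) (Ioi 0) := hσ.ofReal
  have h2 : IntegrableOn (fun t : ℝ => Complex.exp (-(s - σ) * (t : ℂ)) *
      ((Real.exp (-σ * t) * f t : ℝ) : ℂ)) (Ioi 0) := by
    refine Integrable.bdd_mul (c := 1) h1 ?_ ?_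
    · exact (by fun_prop : Continuous fun t : ℝ =>
        Complex.exp (-(s - σ) * (t : ℂ))).aestronglyMeasurable
    · refine (ae_restrict_iff' measurableSet_Ioi).2 (Eventually.of_forall fun t ht => ?_)
      rw [Complex.norm_exp, Real.exp_le_one_iff]
      have : 0 < t := ht
      simp
      nlinarith
  refine h2.congr (Eventually.of_forall fun t => ?_)
  simp only
  push_cast
  rw [← mul_assoc, ← Complex.exp_add]
  ring_nf

theorem LaplaceTransformable.of_integrableOn {f : ℝ → ℝ} (σ : ℝ)
    (h : IntegrableOn (fun t : ℝ => Complex.exp (-(σ : ℂ) * (t : ℂ)) * ((f t : ℝ) : ℂ)) (Ioi 0)) :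
    LaplaceTransformable f := by
  refine ⟨σ, ?_⟩
  have := h.re
  refine this.congr (Eventually.of_forall fun t => ?_)
  simp only [RCLike.re_to_complex]
  rw [show Complex.exp (-(σ : ℂ) * (t : ℂ)) = ((Real.exp (-σ * t) : ℝ) : ℂ) by push_cast; rfl,
    ← Complex.ofReal_mul, Complex.ofReal_re]

/-- `F` agrees on some right half-plane with the Laplace transform of the signal `f`. -/
def HasLaplace (f : ℝ → ℝ) (F : ℂ → ℂ) : Prop :=
  LaplaceTransformable f ∧ ∀ᶠ s in rightHalfPlanes, laplace f s = F s

theorem LaplaceTransformable.hasLaplace {f : ℝ → ℝ} (hf : LaplaceTransformable f) :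
    HasLaplace f (laplace f) := ⟨hf, Eventually.of_forall fun _ => rfl⟩

theorem HasLaplace.congr {f : ℝ → ℝ} {F G : ℂ → ℂ} (hf : HasLaplace f F)
    (h : F =ᶠ[rightHalfPlanes] G) : HasLaplace f G :=
  ⟨hf.1, by filter_upwards [hf.2, h] with s h1 h2 using h1.trans h2⟩

theorem HasLaplace.congr_ae {f g : ℝ → ℝ} {F : ℂ → ℂ} (hf : HasLaplace f F)
    (h : f =ᵐ[volume.restrict (Ioi 0)] g) : HasLaplace g F := by
  obtain ⟨⟨σ, hσ⟩, h2⟩ := hf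
  refine ⟨⟨σ, hσ.congr ?_⟩, ?_⟩
  · filter_upwards [h] with t ht
    rw [ht]
  · filter_upwards [h2] with s hs
    rw [← hs]
    refine integral_congr_ae ?_
    filter_upwards [h] with t ht
    rw [ht]

theorem hasLaplace_of_integrableOn {f : ℝ → ℝ} {F : ℂ → ℂ}
    (h : ∀ᶠ s in rightHalfPlanes,
      IntegrableOn (fun t : ℝ => Complex.exp (-s * (t : ℂ)) * ((f t : ℝ) : ℂ)) (Ioi 0) ∧
      laplace f s = F s) : HasLaplace f F := by
  refine ⟨?_, h.mono fun s hs => hs.2⟩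
  obtain ⟨σ, hσ⟩ := eventually_rightHalfPlanes.1 h
  exact .of_integrableOn σ (hσ (σ : ℂ) (by simp)).1

theorem LaplaceTransformable.eventually_integrableOn {f : ℝ → ℝ} (hf : LaplaceTransformable f) :
    ∀ᶠ s in rightHalfPlanes,
      IntegrableOn (fun t : ℝ => Complex.exp (-s * (t : ℂ)) * ((f t : ℝ) : ℂ)) (Ioi 0) :=
  eventually_rightHalfPlanes.2 hf.exists_integrableOn

theorem HasLaplace.add {f g : ℝ → ℝ} {F G : ℂ → ℂ} (hf : HasLaplace f F) (hg : HasLaplace g G) :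
    HasLaplace (fun t => f t + g t) (fun s => F s + G s) := by
  refine hasLaplace_of_integrableOn ?_
  filter_upwards [hf.2, hg.2, hf.1.eventually_integrableOn, hg.1.eventually_integrableOn]
    with s h1 h2 h3 h4
  rw [← h1, ← h2, laplace, laplace, laplace, ← integral_add h3 h4]
  simp only [Complex.ofReal_add, mul_add]
  exact ⟨h3.add h4, trivial⟩

theorem HasLaplace.const_mul {f : ℝ → ℝ} {F : ℂ → ℂ} (hf : HasLaplace f F) (c : ℝ) :
    HasLaplace (fun t => c * f t) (fun s => c * F s) := by
  refine hasLaplace_of_integrableOn ?_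
  filter_upwards [hf.2, hf.1.eventually_integrableOn] with s h1 h3
  rw [← h1, laplace, laplace, ← integral_const_mul]
  simp only [Complex.ofReal_mul, mul_left_comm _ (c : ℂ)]
  exact ⟨h3.const_mul _, trivial⟩

theorem HasLaplace.sub {f g : ℝ → ℝ} {F G : ℂ → ℂ} (hf : HasLaplace f F) (hg : HasLaplace g G) :
    HasLaplace (fun t => f t - g t) (fun s => F s - G s) := by
  have := hf.add (hg.const_mul (-1))
  simpa [sub_eq_add_neg] using this

theorem hasLaplace_zero : HasLaplace (fun _ => 0) (fun _ => 0) :=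
  hasLaplace_of_integrableOn (Eventually.of_forall fun s => by simp [laplace])

theorem HasLaplace.sum {ι : Type*} (S : Finset ι) {f : ι → ℝ → ℝ} {F : ι → ℂ → ℂ}
    (hf : ∀ i ∈ S, HasLaplace (f i) (F i)) :
    HasLaplace (fun t => ∑ i ∈ S, f i t) (fun s => ∑ i ∈ S, F i s) := by
  classical
  induction S using Finset.induction_on with
  | empty => simpa using hasLaplace_zero
  | insert a S ha ih =>
    simp only [Finset.sum_insert ha]
    exact (hf a (by simp)).add (ih fun i hi => hf i (by simp [hi]))

/-! ### Uniqueness of the Laplace transform -/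

/-- The finite measures with densities `h⁺` and `h⁻` have the same characteristic function, so they
coincide, and `h⁺ = h⁻` almost everywhere. -/
theorem ae_eq_zero_of_integral_exp_eq_zero {μ : Measure ℝ} [SigmaFinite μ] {h : ℝ → ℝ}
    (hh : Integrable h μ)
    (H : ∀ ω : ℝ, ∫ x : ℝ, Complex.exp (ω * x * Complex.I) * ((h x : ℝ) : ℂ) ∂μ = 0) :
    h =ᵐ[μ] 0 := by
  have key : ∀ g : ℝ → ℝ, Integrable g μ → ∀ ω : ℝ,
      charFun (μ.withDensity fun x => ENNReal.ofReal (g x)) ω =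
        ∫ x : ℝ, Complex.exp (ω * x * Complex.I) * ((max (g x) 0 : ℝ) : ℂ) ∂μ := by
    intro g hg ω
    rw [charFun_apply_real, integral_withDensity_eq_integral_toReal_smul₀]
    · refine integral_congr_ae (Eventually.of_forall fun x => ?_)
      simp only [ENNReal.toReal_ofReal', Complex.real_smul]
      ring
    · exact hg.aestronglyMeasurable.aemeasurable.ennreal_ofReal
    · exact Eventually.of_forall fun x => ENNReal.ofReal_lt_top
  have hint : ∀ g : ℝ → ℝ, Integrable g μ → ∀ ω : ℝ,
      Integrable (fun x : ℝ => Complex.exp (ω * x * Complex.I) * ((max (g x) 0 : ℝ) : ℂ)) μ := by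
    intro g hg ω
    refine Integrable.bdd_mul (c := 1) (hg.pos_part.ofReal) ?_ ?_
    · exact (by fun_prop : Continuous fun x : ℝ =>
        Complex.exp (ω * x * Complex.I)).aestronglyMeasurable
    · refine Eventually.of_forall fun x => ?_
      rw [← Complex.ofReal_mul, Complex.norm_exp_ofReal_mul_I]
  have hfin : ∀ g : ℝ → ℝ, Integrable g μ → ∫⁻ x, ENNReal.ofReal (g x) ∂μ ≠ ⊤ := by
    intro g hg
    exact hg.lintegral_lt_top.ne
  have i1 : IsFiniteMeasure (μ.withDensity fun x => ENNReal.ofReal (h x)) :=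
    isFiniteMeasure_withDensity (hfin h hh)
  have i2 : IsFiniteMeasure (μ.withDensity fun x => ENNReal.ofReal ((-h) x)) :=
    isFiniteMeasure_withDensity (hfin (-h) hh.neg)
  have heq : (μ.withDensity fun x => ENNReal.ofReal (h x)) =
      (μ.withDensity fun x => ENNReal.ofReal ((-h) x)) := by
    apply Measure.ext_of_charFun
    funext ω
    rw [key h hh, key (-h) hh.neg, ← sub_eq_zero,
      ← integral_sub (hint h hh ω) (hint (-h) hh.neg ω), ← H ω]
    refine integral_congr_ae (Eventually.of_forall fun x => ?_)
    simp only [← mul_sub, ← Complex.ofReal_sub, Pi.neg_apply]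
    congr 2
    rcases le_total (h x) 0 with h0 | h0
    · rw [max_eq_right h0, max_eq_left (by linarith)]; ring
    · rw [max_eq_left h0, max_eq_right (by linarith)]; ring
  rw [withDensity_eq_iff hh.aestronglyMeasurable.aemeasurable.ennreal_ofReal
    hh.neg.aestronglyMeasurable.aemeasurable.ennreal_ofReal (hfin h hh)] at heq
  filter_upwards [heq] with x hx
  have := congrArg ENNReal.toReal hx
  simp only [ENNReal.toReal_ofReal', Pi.neg_apply] at this
  simp only [Pi.zero_apply]
  rcases le_total (h x) 0 with h0 | h0
  · rw [max_eq_right h0, max_eq_left (by linarith)] at this; linarith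
  · rw [max_eq_left h0, max_eq_right (by linarith)] at this; linarith

/-- Lerch's theorem: a signal with vanishing Laplace transform vanishes almost everywhere. -/
theorem HasLaplace.ae_eq_zero {f : ℝ → ℝ} (hf : HasLaplace f fun _ => 0) :
    f =ᵐ[volume.restrict (Ioi 0)] fun _ => 0 := by
  obtain ⟨σ, hσ⟩ := eventually_rightHalfPlanes.1 (hf.2.and hf.1.eventually_integrableOn)
  have hint := (hσ (σ : ℂ) (by simp)).2
  have hint' : IntegrableOn (fun t : ℝ => Real.exp (-σ * t) * f t) (Ioi 0) := by
    refine hint.re.congr (Eventually.of_forall fun t => ?_)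
    simp only [RCLike.re_to_complex]
    rw [show Complex.exp (-(σ : ℂ) * (t : ℂ)) = ((Real.exp (-σ * t) : ℝ) : ℂ) by push_cast; rfl,
      ← Complex.ofReal_mul, Complex.ofReal_re]
  have := ae_eq_zero_of_integral_exp_eq_zero hint' (fun ω => by
    -- On the vertical line `Re s = σ` the Laplace transform of `f` is the Fourier integral of
    -- `e^{-σ t} f(t)`.
    have h1 := (hσ (σ - ω * Complex.I) (by simp)).1
    refine Eq.trans ?_ h1
    rw [laplace]
    refine integral_congr_ae (Eventually.of_forall fun t => ?_)
    simp only
    push_cast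
    rw [← mul_assoc, ← Complex.exp_add]
    ring_nf)
  filter_upwards [this] with t ht
  simpa [(Real.exp_pos _).ne'] using ht

theorem HasLaplace.ae_eq {f g : ℝ → ℝ} {F : ℂ → ℂ} (hf : HasLaplace f F) (hg : HasLaplace g F) :
    f =ᵐ[volume.restrict (Ioi 0)] g := by
  have h := ((hf.sub hg).congr (G := fun _ => 0)
    (Eventually.of_forall fun s => sub_self _)).ae_eq_zero
  filter_upwards [h] with t ht
  linarith

/-! ### Convolution -/

/-- The one-sided convolution of a kernel `φ` with a signal `u`. -/
noncomputable def conv (φ u : ℝ → ℝ) (t : ℝ) : ℝ := ∫ τ in (0 : ℝ)..t, u τ * φ (t - τ)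

theorem conv_zero_right (φ u : ℝ → ℝ) : conv φ u 0 = 0 := by simp [conv]

/-- Since `e^{-s x} = e^{-s t} e^{-s (x - t)}`, damping commutes with convolution; the rest is
Fubini for one-sided convolutions. -/
theorem laplace_conv {φ u : ℝ → ℝ} {s : ℂ}
    (hφ : IntegrableOn (fun t : ℝ => Complex.exp (-s * (t : ℂ)) * ((φ t : ℝ) : ℂ)) (Ioi 0))
    (hu : IntegrableOn (fun t : ℝ => Complex.exp (-s * (t : ℂ)) * ((u t : ℝ) : ℂ)) (Ioi 0)) :
    IntegrableOn (fun t : ℝ => Complex.exp (-s * (t : ℂ)) * ((conv φ u t : ℝ) : ℂ)) (Ioi 0) ∧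
      laplace (conv φ u) s = laplace φ s * laplace u s := by
  have key : ∀ x : ℝ, (∫ t in (0 : ℝ)..x, ContinuousLinearMap.mul ℝ ℂ
      (Complex.exp (-s * (t : ℂ)) * ((u t : ℝ) : ℂ))
      (Complex.exp (-s * ((x - t : ℝ) : ℂ)) * ((φ (x - t) : ℝ) : ℂ))) =
      Complex.exp (-s * (x : ℂ)) * ((conv φ u x : ℝ) : ℂ) := by
    intro x
    rw [conv, ← intervalIntegral.integral_ofReal, ← intervalIntegral.integral_const_mul]
    refine intervalIntegral.integral_congr fun t _ => ?_
    simp only [ContinuousLinearMap.mul_apply']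
    rw [mul_mul_mul_comm, ← Complex.exp_add]
    push_cast
    ring_nf
  constructor
  · have := integrable_posConvolution hu hφ (ContinuousLinearMap.mul ℝ ℂ)
    refine (this.integrableOn (s := Ioi 0)).congr ?_
    refine (ae_restrict_iff' measurableSet_Ioi).2 (Eventually.of_forall fun x hx => ?_)
    rw [posConvolution, indicator_of_mem hx]
    exact key x
  · have := integral_posConvolution hu hφ (ContinuousLinearMap.mul ℝ ℂ)
    simp only [key] at this
    rw [laplace, this, ContinuousLinearMap.mul_apply', mul_comm]
    rfl

theorem HasLaplace.conv {φ u : ℝ → ℝ} {F U : ℂ → ℂ} (hφ : HasLaplace φ F) (hu : HasLaplace u U) :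
    HasLaplace (conv φ u) (fun s => F s * U s) := by
  refine hasLaplace_of_integrableOn ?_
  filter_upwards [hφ.2, hu.2, hφ.1.eventually_integrableOn, hu.1.eventually_integrableOn]
    with s h1 h2 h3 h4
  rw [← h1, ← h2]
  exact laplace_conv h3 h4

theorem LaplaceTransformable.integrableOn_Ioc {u : ℝ → ℝ} (hu : LaplaceTransformable u) (T : ℝ) :
    IntegrableOn u (Ioc 0 T) := by
  obtain ⟨σ, hσ⟩ := hu
  have h1 := hσ.mono_set (Ioc_subset_Ioi_self : Ioc 0 T ⊆ Ioi 0)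
  have h2 : IntegrableOn (fun t => Real.exp (σ * t) * (Real.exp (-σ * t) * u t)) (Ioc 0 T) := by
    refine Integrable.bdd_mul (c := Real.exp (|σ| * T)) h1 ?_ ?_
    · exact (by fun_prop : Continuous fun t : ℝ => Real.exp (σ * t)).aestronglyMeasurable
    · refine (ae_restrict_iff' measurableSet_Ioc).2 (Eventually.of_forall fun t ht => ?_)
      rw [Real.norm_eq_abs, Real.abs_exp, Real.exp_le_exp]
      exact mul_le_mul (le_abs_self σ) ht.2 ht.1.le (abs_nonneg σ)
  refine h2.congr (Eventually.of_forall fun t => ?_)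
  simp only
  rw [← mul_assoc, ← Real.exp_add]
  simp

theorem continuousOn_conv {φ u : ℝ → ℝ} (hφ : Continuous φ) {T : ℝ}
    (hu : IntegrableOn u (Ioc 0 T)) : ContinuousOn (conv φ u) (Icc 0 T) := by
  rcases lt_or_ge T 0 with hT | hT
  · rw [Icc_eq_empty (not_le.2 hT)]; exact continuousOn_empty _
  obtain ⟨B, hB⟩ := (isCompact_Icc (a := (0 : ℝ)) (b := T)).exists_bound_of_continuousOn
    hφ.continuousOn
  have hui : IntervalIntegrable u volume 0 T := (intervalIntegrable_iff_integrableOn_Ioc_of_le hT).2 hu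
  -- As `u` is merely integrable, continuity comes from dominated convergence; the indicator moves
  -- the variable endpoint into the integrand.
  have hrep : ∀ x ∈ Icc (0 : ℝ) T, conv φ u x =
      ∫ τ in (0 : ℝ)..T, (Iic x).indicator (fun τ => u τ * φ (x - τ)) τ := by
    intro x hx
    rw [conv, intervalIntegral.integral_of_le hx.1, intervalIntegral.integral_of_le hT,
      setIntegral_indicator measurableSet_Iic, Ioc_inter_Iic, min_eq_right hx.2]
  refine ContinuousOn.congr ?_ hrep
  intro x₀ hx₀
  refine intervalIntegral.continuousWithinAt_of_dominated_interval (bound := fun τ => |B| * |u τ|)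
    ?_ ?_ ?_ ?_
  · filter_upwards with x
    rw [uIoc_of_le hT]
    refine AEStronglyMeasurable.indicator ?_ measurableSet_Iic
    exact hu.aestronglyMeasurable.mul
      (by fun_prop : Continuous fun τ : ℝ => φ (x - τ)).aestronglyMeasurable
  · filter_upwards [self_mem_nhdsWithin] with x hx
    refine Eventually.of_forall fun τ hτ => ?_
    rw [uIoc_of_le hT] at hτ
    by_cases h : τ ∈ Iic x
    · rw [indicator_of_mem h, norm_mul, mul_comm]
      refine mul_le_mul_of_nonneg_right ?_ (abs_nonneg _)
      exact (hB (x - τ) ⟨by simpa using h, by linarith [hx.2, hτ.1]⟩).trans (le_abs_self B)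
    · rw [indicator_of_notMem h, norm_zero]
      positivity
  · exact hui.abs.const_mul _
  · have : ∀ᵐ τ : ℝ, τ ≠ x₀ := by
      simp [ae_iff]
    filter_upwards [this] with τ hτ _
    refine ContinuousAt.continuousWithinAt ?_
    rcases lt_or_gt_of_ne hτ with h | h
    · have : (fun x => u τ * φ (x - τ)) =ᶠ[𝓝 x₀]
          fun x => (Iic x).indicator (fun τ => u τ * φ (x - τ)) τ := by
        filter_upwards [lt_mem_nhds h] with x hx
        rw [indicator_of_mem (mem_Iic.2 hx.le)]
      refine ContinuousAt.congr ?_ this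
      fun_prop
    · have : (fun _ => (0 : ℝ)) =ᶠ[𝓝 x₀]
          fun x => (Iic x).indicator (fun τ => u τ * φ (x - τ)) τ := by
        filter_upwards [gt_mem_nhds h] with x hx
        rw [indicator_of_notMem (by simpa using hx)]
      exact continuousAt_const.congr this

theorem conv_congr_ae {φ u v : ℝ → ℝ} {T t : ℝ} (h : u =ᵐ[volume.restrict (Icc 0 T)] v)
    (ht : t ∈ Icc 0 T) : conv φ u t = conv φ v t := by
  refine intervalIntegral.integral_congr_ae ?_
  rw [uIoc_of_le ht.1]
  have h' := (ae_restrict_iff' measurableSet_Icc).1 h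
  filter_upwards [h'] with τ hτ hτ'
  rw [hτ ⟨hτ'.1.le, hτ'.2.trans ht.2⟩]

theorem ae_restrict_Icc_of_Ioi {p : ℝ → Prop} {T : ℝ} (h : ∀ᵐ t ∂volume.restrict (Ioi (0 : ℝ)), p t) :
    ∀ᵐ t ∂volume.restrict (Icc (0 : ℝ) T), p t := by
  rw [← restrict_Ioc_eq_restrict_Icc]
  exact ae_mono (Measure.restrict_mono Ioc_subset_Ioi_self le_rfl) h

/-! ### Transforms of powers and of exponential series -/

theorem laplace_const (c : ℝ) {s : ℂ} (hs : 0 < s.re) :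
    IntegrableOn (fun t : ℝ => Complex.exp (-s * (t : ℂ)) * ((c : ℝ) : ℂ)) (Ioi 0) ∧
      laplace (fun _ => c) s = c / s := by
  have h0 : (-s).re < 0 := by simpa using hs
  refine ⟨(integrableOn_exp_mul_complex_Ioi h0 0).mul_const _, ?_⟩
  rw [laplace, integral_mul_const, integral_exp_mul_complex_Ioi h0]
  simp
  field_simp

theorem hasLaplace_const (c : ℝ) : HasLaplace (fun _ => c) (fun s => c / s) :=
  hasLaplace_of_integrableOn (eventually_rightHalfPlanes.2
    ⟨1, fun _ hs => laplace_const c (by linarith)⟩)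

theorem conv_one_pow_div_factorial (n : ℕ) :
    conv (fun _ => 1) (fun t => t ^ n / (n.factorial : ℝ)) =
      fun t => t ^ (n + 1) / ((n + 1).factorial : ℝ) := by
  funext t
  simp only [conv, mul_one]
  rw [intervalIntegral.integral_div, integral_pow, Nat.factorial_succ]
  push_cast
  simp
  field_simp

theorem laplace_pow_div_factorial (n : ℕ) {s : ℂ} (hs : 0 < s.re) :
    IntegrableOn (fun t : ℝ => Complex.exp (-s * (t : ℂ)) *
      ((t ^ n / (n.factorial : ℝ) : ℝ) : ℂ)) (Ioi 0) ∧
      laplace (fun t => t ^ n / (n.factorial : ℝ)) s = (s⁻¹) ^ (n + 1) := by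
  induction n with
  | zero => simpa using laplace_const 1 hs
  | succ n ih =>
    have h := laplace_conv (laplace_const 1 hs).1 ih.1
    rw [conv_one_pow_div_factorial, ih.2, (laplace_const 1 hs).2] at h
    refine ⟨h.1, h.2.trans ?_⟩
    rw [pow_succ' _ (n + 1)]
    simp


section Series

variable {a : ℕ → ℝ} {C R : ℝ}

theorem norm_series_term_le (ha : ∀ n, |a n| ≤ C * R ^ n) (t : ℝ) (n : ℕ) :
    ‖a n * (t ^ n / (n.factorial : ℝ))‖ ≤ C * ((R * |t|) ^ n / (n.factorial : ℝ)) := by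
  rw [norm_mul, norm_div, norm_pow, Real.norm_eq_abs, Real.norm_eq_abs, Real.norm_natCast, mul_pow,
    mul_div_assoc, ← mul_assoc]
  exact mul_le_mul_of_nonneg_right (ha n) (by positivity)

theorem hasSum_series_bound (x : ℝ) :
    HasSum (fun n : ℕ => C * (x ^ n / (n.factorial : ℝ))) (C * Real.exp x) := by
  rw [Real.exp_eq_exp_ℝ]
  exact (NormedSpace.expSeries_div_hasSum_exp x).mul_left C

theorem continuous_series (hR : 0 ≤ R) (hC : 0 ≤ C) (ha : ∀ n, |a n| ≤ C * R ^ n) :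
    Continuous fun t : ℝ => ∑' n : ℕ, a n * (t ^ n / (n.factorial : ℝ)) := by
  rw [continuous_iff_continuousAt]
  intro t₀
  have : ContinuousOn (fun t : ℝ => ∑' n : ℕ, a n * (t ^ n / (n.factorial : ℝ)))
      (Metric.ball 0 (|t₀| + 1)) := by
    refine continuousOn_tsum (fun n => by fun_prop)
      (hasSum_series_bound (C := C) (R * (|t₀| + 1))).summable fun n t ht => ?_
    refine (norm_series_term_le ha t n).trans ?_
    have : |t| ≤ |t₀| + 1 := by
      rw [mem_ball_zero_iff, Real.norm_eq_abs] at ht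
      exact ht.le
    gcongr
  exact this.continuousAt (Metric.isOpen_ball.mem_nhds (by simp))

theorem hasLaplace_series (hR : 0 ≤ R) (hC : 0 ≤ C) (ha : ∀ n, |a n| ≤ C * R ^ n) :
    HasLaplace (fun t : ℝ => ∑' n : ℕ, a n * (t ^ n / (n.factorial : ℝ)))
      (fun s => ∑' n : ℕ, a n * (s⁻¹) ^ (n + 1)) := by
  have hbound : ∀ t : ℝ, |∑' n : ℕ, a n * (t ^ n / (n.factorial : ℝ))| ≤
      C * Real.exp (R * |t|) := fun t =>
    tsum_of_norm_bounded (hasSum_series_bound _) (norm_series_term_le ha t)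
  -- The series is bounded by `C e^{R t}`, so damping with exponent `R + 1` leaves the integrable
  -- majorant `C e^{-t}`.
  refine ⟨⟨R + 1, ?_⟩, ?_⟩
  · have h1 : IntegrableOn (fun t : ℝ => C * Real.exp (-t)) (Ioi 0) := by
      exact (integrableOn_exp_neg_Ioi 0).const_mul C
    refine Integrable.mono' h1 ?_ ?_
    · exact ((by fun_prop : Continuous fun t : ℝ => Real.exp (-(R + 1) * t)).mul
        (continuous_series hR hC ha)).aestronglyMeasurable
    · refine (ae_restrict_iff' measurableSet_Ioi).2 (Eventually.of_forall fun t ht => ?_)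
      rw [norm_mul, Real.norm_eq_abs, Real.norm_eq_abs, Real.abs_exp]
      refine (mul_le_mul_of_nonneg_left (hbound t) (Real.exp_pos _).le).trans ?_
      rw [abs_of_pos ht, mul_left_comm, ← Real.exp_add]
      ring_nf
      rfl
  · refine eventually_rightHalfPlanes.2 ⟨R + 1, fun s hs => ?_⟩
    have hs0 : 0 < s.re := by linarith
    have hint : ∀ n : ℕ, Integrable (fun t : ℝ => Complex.exp (-s * (t : ℂ)) *
        ((a n * (t ^ n / (n.factorial : ℝ)) : ℝ) : ℂ)) (volume.restrict (Ioi 0)) := by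
      intro n
      refine ((laplace_pow_div_factorial n hs0).1.const_mul (a n : ℂ)).congr
        (Eventually.of_forall fun t => ?_)
      push_cast
      ring
    -- Taking absolute values amounts to evaluating the transform at the real point `Re s`; the
    -- norms are then dominated by a geometric series of ratio `R / Re s < 1`, which permits
    -- termwise integration.
    have hnorm : ∀ n : ℕ, ∫ t in Ioi (0 : ℝ), ‖Complex.exp (-s * (t : ℂ)) *
        ((a n * (t ^ n / (n.factorial : ℝ)) : ℝ) : ℂ)‖ = |a n| * (s.re⁻¹) ^ (n + 1) := by
      intro n
      have h := (laplace_pow_div_factorial n (s := (s.re : ℂ)) (by simpa using hs0)).2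
      have h2 : ∫ t in Ioi (0 : ℝ), Real.exp (-s.re * t) * (t ^ n / (n.factorial : ℝ)) =
          (s.re⁻¹) ^ (n + 1) := by
        rw [← Complex.ofReal_inj, ← integral_complex_ofReal]
        push_cast
        rw [← h, laplace]
        push_cast
        rfl
      rw [← h2, ← integral_const_mul]
      refine setIntegral_congr_fun measurableSet_Ioi fun t ht => ?_
      have ht : 0 < t := ht
      simp only [norm_mul, Complex.norm_exp, Complex.norm_real, norm_div, norm_pow,
        Real.norm_eq_abs, abs_of_pos ht, Nat.abs_cast]
      simp
      ring
    have hsum : Summable fun n : ℕ => ∫ t in Ioi (0 : ℝ), ‖Complex.exp (-s * (t : ℂ)) *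
        ((a n * (t ^ n / (n.factorial : ℝ)) : ℝ) : ℂ)‖ := by
      simp only [hnorm]
      refine Summable.of_nonneg_of_le (fun n => by positivity) (fun n => ?_)
        ((summable_geometric_of_lt_one (r := R / s.re) (by positivity)
          ((div_lt_one hs0).2 (by linarith))).mul_left (C * s.re⁻¹))
      refine (mul_le_mul_of_nonneg_right (ha n) (by positivity)).trans (le_of_eq ?_)
      rw [div_eq_mul_inv, mul_pow]
      ring
    have h := hasSum_integral_of_summable_integral_norm hint hsum
    have hterm : ∀ n : ℕ, ∫ t in Ioi (0 : ℝ), Complex.exp (-s * (t : ℂ)) *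
        ((a n * (t ^ n / (n.factorial : ℝ)) : ℝ) : ℂ) = a n * (s⁻¹) ^ (n + 1) := by
      intro n
      rw [← (laplace_pow_div_factorial n hs0).2, laplace, ← integral_const_mul]
      refine integral_congr_ae (Eventually.of_forall fun t => ?_)
      push_cast
      ring
    simp only [hterm] at h
    refine Eq.trans ?_ h.tsum_eq.symm
    rw [laplace]
    refine integral_congr_ae (Eventually.of_forall fun t => ?_)
    simp only
    rw [tsum_mul_left, Complex.ofReal_tsum]

end Series

/-! ### Rational functions at infinity -/

/-- The value of a real rational function at a complex number. -/
noncomputable abbrev evalC (f : RatFunc ℝ) (s : ℂ) : ℂ := RatFunc.eval (algebraMap ℝ ℂ) s f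

theorem eventually_eval₂_ne_zero {p : Polynomial ℝ} (hp : p ≠ 0) :
    ∀ᶠ s in Bornology.cobounded ℂ, Polynomial.eval₂ (algebraMap ℝ ℂ) s p ≠ 0 := by
  have hp' : p.map (algebraMap ℝ ℂ) ≠ 0 :=
    (Polynomial.map_ne_zero_iff (algebraMap ℝ ℂ).injective).2 hp
  have hfin : {s : ℂ | (p.map (algebraMap ℝ ℂ)).IsRoot s}.Finite := Polynomial.finite_setOfPred_isRoot hp'
  have := hfin.isBounded
  filter_upwards [Bornology.isBounded_def.1 this] with s hs h0
  exact hs (by simpa [Polynomial.IsRoot, Polynomial.eval_map] using h0)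

theorem eventually_denom_ne_zero (f : RatFunc ℝ) :
    ∀ᶠ s in Bornology.cobounded ℂ, Polynomial.eval₂ (algebraMap ℝ ℂ) s f.denom ≠ 0 :=
  eventually_eval₂_ne_zero f.denom_ne_zero

/-- This symmetry is what makes the inverse transform real-valued. -/
theorem evalC_conj (f : RatFunc ℝ) (s : ℂ) :
    evalC f (starRingEnd ℂ s) = starRingEnd ℂ (evalC f s) := by
  have h : (starRingEnd ℂ).comp (algebraMap ℝ ℂ) = algebraMap ℝ ℂ := by
    ext x; simp
  simp only [evalC, RatFunc.eval, map_div₀, Polynomial.hom_eval₂, h]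

theorem differentiableAt_evalC (f : RatFunc ℝ) {s : ℂ}
    (h : Polynomial.eval₂ (algebraMap ℝ ℂ) s f.denom ≠ 0) : DifferentiableAt ℂ (evalC f) s := by
  have h' : (f.denom.map (algebraMap ℝ ℂ)).eval s ≠ 0 := by rwa [Polynomial.eval_map]
  have : evalC f = fun s => (f.num.map (algebraMap ℝ ℂ)).eval s /
      (f.denom.map (algebraMap ℝ ℂ)).eval s := by
    funext s
    simp [evalC, RatFunc.eval, Polynomial.eval_map]
  rw [this]
  exact (Polynomial.differentiable _ _).div (Polynomial.differentiable _ _) h'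

/-- A rational function vanishing at infinity is the Laplace transform of a continuous function. -/
theorem exists_inverseLaplace (f : RatFunc ℝ) (hf : Tendsto (evalC f) (Bornology.cobounded ℂ) (𝓝 0)) :
    ∃ φ : ℝ → ℝ, Continuous φ ∧ HasLaplace φ (evalC f) ∧
      Tendsto (fun s => s * evalC f s) (Bornology.cobounded ℂ) (𝓝 ((φ 0 : ℝ) : ℂ)) := by
  -- In the coordinate `z = 1 / s` infinity becomes a removable singularity, filled with the limit
  -- `0`.
  set g : ℂ → ℂ := Function.update (fun z => evalC f z⁻¹) 0 0 with hg
  have hg0 : g 0 = 0 := by simp [hg]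
  have hgz : ∀ z, z ≠ 0 → g z = evalC f z⁻¹ := fun z hz => by simp [hg, hz]
  have hana : AnalyticAt ℂ g 0 := by
    refine Complex.analyticAt_of_differentiable_on_punctured_nhds_of_continuousAt ?_ ?_
    · filter_upwards [tendsto_inv₀_nhdsNE_zero.eventually (eventually_denom_ne_zero f),
        self_mem_nhdsWithin] with z hz hz0
      have hz0 : z ≠ 0 := hz0
      have : DifferentiableAt ℂ (fun z => evalC f z⁻¹) z :=
        (differentiableAt_evalC f hz).comp z (differentiableAt_inv hz0)
      refine this.congr_of_eventuallyEq ?_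
      filter_upwards [isOpen_ne.mem_nhds hz0] with w hw using hgz w hw
    · rw [continuousAt_iff_punctured_nhds, hg0]
      refine (hf.comp tendsto_inv₀_nhdsNE_zero).congr' ?_
      filter_upwards [self_mem_nhdsWithin] with z hz using (hgz z hz).symm
  obtain ⟨p, hp⟩ := hana
  -- Dividing by `z` gives the expansion of `s f(s)` in powers of `1 / s`; its constant term is both
  -- `lim s f(s)` and the value `φ 0`.
  have hq := hp.has_fpower_series_dslope_fslope
  set k := dslope g 0
  have hkz : ∀ z, z ≠ 0 → k z = z⁻¹ * evalC f z⁻¹ := by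
    intro z hz
    rw [show k z = slope g 0 z from dslope_of_ne g hz, slope_def_field, hg0, hgz z hz]
    ring
  have hkconj : ∀ z, z ≠ 0 → k (starRingEnd ℂ z) = starRingEnd ℂ (k z) := by
    intro z hz
    rw [hkz z hz, hkz _ (by simpa using hz), map_mul, ← evalC_conj, map_inv₀]
  have hev := hasFPowerSeriesAt_iff.1 hq
  simp only [zero_add, smul_eq_mul] at hev
  set b : ℕ → ℂ := fun n => p.fslope.coeff n with hb
  have hkcont : ContinuousAt k 0 := hq.continuousAt
  have hlim : Tendsto (fun s => s * evalC f s) (Bornology.cobounded ℂ) (𝓝 (k 0)) := by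
    have h1 := (continuousAt_iff_punctured_nhds.1 hkcont).comp (tendsto_inv₀_cobounded' (α := ℂ))
    refine h1.congr' ?_
    filter_upwards [Bornology.eventually_ne_cobounded (0 : ℂ)] with s hs
    simp only [Function.comp]
    rw [hkz _ (inv_ne_zero hs), inv_inv]
  have hk0 : k 0 = (((b 0).re : ℝ) : ℂ) := by
    have h0 : k 0 = b 0 := (hq.coeff_zero 1).symm
    have hconj : starRingEnd ℂ (k 0) = k 0 := by
      have h1 : Tendsto (fun z => starRingEnd ℂ (k z)) (𝓝[≠] 0) (𝓝 (starRingEnd ℂ (k 0))) :=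
        (Complex.continuous_conj.tendsto _).comp (continuousAt_iff_punctured_nhds.1 hkcont)
      have h2 : Tendsto (fun z => k (starRingEnd ℂ z)) (𝓝[≠] 0) (𝓝 (k 0)) := by
        have h3 : Tendsto (starRingEnd ℂ) (𝓝[≠] 0) (𝓝 0) := by
          have := Complex.continuous_conj.tendsto 0
          rw [map_zero] at this
          exact this.mono_left nhdsWithin_le_nhds
        exact hkcont.tendsto.comp h3
      refine tendsto_nhds_unique h1 (h2.congr' ?_)
      filter_upwards [self_mem_nhdsWithin] with z hz using hkconj z hz
    rw [← h0]
    exact (Complex.conj_eq_iff_re.1 hconj).symm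
  obtain ⟨r, hr, hball⟩ := Metric.eventually_nhds_iff.1 hev
  -- Averaging the expansion with its conjugate replaces the coefficients by their real parts
  -- without changing the sum.
  have hsumr : ∀ z : ℂ, z ≠ 0 → ‖z‖ < r → HasSum (fun n => (((b n).re : ℝ) : ℂ) * z ^ n) (k z) := by
    intro z hz hzr
    have h1 := hball (y := z) (by simpa using hzr)
    have h2 := hball (y := starRingEnd ℂ z) (by simpa using hzr)
    have h3 := h2.map (starRingEnd ℂ) Complex.continuous_conj
    rw [hkconj z hz, Complex.conj_conj] at h3
    have h4 := (h1.add h3).div_const 2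
    rw [add_self_div_two] at h4
    refine h4.congr_fun fun n => ?_
    simp only [Function.comp, map_mul, map_pow, Complex.conj_conj]
    rw [← mul_add, Complex.add_conj]
    push_cast
    ring
  -- Summability at a point inside the disc gives the Cauchy-type bound `|bₙ| ≤ C ρ⁻ⁿ`.
  set ρ : ℝ := r / 2 with hρ
  have hρ0 : 0 < ρ := by positivity
  have hρr : ‖(ρ : ℂ)‖ < r := by
    rw [Complex.norm_real, Real.norm_eq_abs, abs_of_pos hρ0, hρ]; linarith
  have hsum := (hsumr ρ (by exact_mod_cast hρ0.ne') hρr).summable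
  set C : ℝ := ∑' n, ‖(((b n).re : ℝ) : ℂ) * (ρ : ℂ) ^ n‖ with hC
  have hC0 : 0 ≤ C := tsum_nonneg fun n => norm_nonneg _
  have ha : ∀ n, |(b n).re| ≤ C * (ρ⁻¹) ^ n := by
    intro n
    have h1 : ‖(((b n).re : ℝ) : ℂ) * (ρ : ℂ) ^ n‖ ≤ C :=
      hsum.norm.le_tsum n fun _ _ => norm_nonneg _
    rw [norm_mul, norm_pow, Complex.norm_real, Complex.norm_real, Real.norm_eq_abs,
      Real.norm_eq_abs, abs_of_pos hρ0] at h1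
    rw [inv_pow, ← div_eq_mul_inv]
    exact (le_div_iff₀ (by positivity)).2 h1
  refine ⟨_, continuous_series (inv_nonneg.2 hρ0.le) hC0 ha,
    (hasLaplace_series (inv_nonneg.2 hρ0.le) hC0 ha).congr ?_, ?_⟩
  · refine Eventually.filter_mono rightHalfPlanes_le_cobounded ?_
    have hsmall : ∀ᶠ s : ℂ in Bornology.cobounded ℂ, ‖s⁻¹‖ < r := by
      have := (tendsto_inv₀_cobounded (α := ℂ)).eventually (Metric.ball_mem_nhds 0 hr)
      simpa using this
    filter_upwards [hsmall, Bornology.eventually_ne_cobounded (0 : ℂ)] with s hs hs0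
    have h1 := ((hsumr s⁻¹ (inv_ne_zero hs0) hs).mul_left s⁻¹).tsum_eq
    rw [hkz _ (inv_ne_zero hs0), inv_inv, ← mul_assoc, inv_mul_cancel₀ hs0, one_mul] at h1
    rw [← h1]
    refine tsum_congr fun n => ?_
    ring
  · rw [hk0] at hlim
    convert hlim using 3
    rw [tsum_eq_single 0 fun n hn => by simp [hn]]
    simp


/-! ### Evaluation of rational functions and matrices near infinity -/

/-- Evaluation returns `0` at a pole, so it respects the algebraic operations only off the finitely
many poles; hence the "eventually" here and below. -/
theorem eventually_evalC_add (f g : RatFunc ℝ) :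
    ∀ᶠ s in Bornology.cobounded ℂ, evalC (f + g) s = evalC f s + evalC g s := by
  filter_upwards [eventually_denom_ne_zero f, eventually_denom_ne_zero g] with s hf hg
  exact RatFunc.eval_add _ _ hf hg

theorem eventually_evalC_mul (f g : RatFunc ℝ) :
    ∀ᶠ s in Bornology.cobounded ℂ, evalC (f * g) s = evalC f s * evalC g s := by
  filter_upwards [eventually_denom_ne_zero f, eventually_denom_ne_zero g] with s hf hg
  exact RatFunc.eval_mul _ _ hf hg

theorem evalC_zero (s : ℂ) : evalC 0 s = 0 := RatFunc.eval_zero _ _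

theorem evalC_one (s : ℂ) : evalC 1 s = 1 := RatFunc.eval_one _ _

theorem evalC_C (c : ℝ) (s : ℂ) : evalC (RatFunc.C c) s = c := RatFunc.eval_C _ _

theorem evalC_X (s : ℂ) : evalC RatFunc.X s = s := RatFunc.eval_X _ _

theorem eventually_evalC_sum {ι : Type*} (S : Finset ι) (f : ι → RatFunc ℝ) :
    ∀ᶠ s in Bornology.cobounded ℂ, evalC (∑ i ∈ S, f i) s = ∑ i ∈ S, evalC (f i) s := by
  classical
  induction S using Finset.induction_on with
  | empty => simp
  | insert a S ha ih =>
    simp only [Finset.sum_insert ha]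
    filter_upwards [ih, eventually_evalC_add (f a) (∑ i ∈ S, f i)] with s h1 h2
    rw [h2, h1]

theorem eventually_evalC_neg (f : RatFunc ℝ) :
    ∀ᶠ s in Bornology.cobounded ℂ, evalC (-f) s = -evalC f s := by
  filter_upwards [eventually_evalC_add f (-f)] with s h
  rw [add_neg_cancel, evalC_zero] at h
  linear_combination -h

theorem eventually_evalC_sub (f g : RatFunc ℝ) :
    ∀ᶠ s in Bornology.cobounded ℂ, evalC (f - g) s = evalC f s - evalC g s := by
  filter_upwards [eventually_evalC_add f (-g), eventually_evalC_neg g] with s h h'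
  rw [sub_eq_add_neg, h, h', sub_eq_add_neg]

theorem eq_zero_of_eventually_evalC {f : RatFunc ℝ}
    (h : ∀ᶠ s in Bornology.cobounded ℂ, evalC f s = 0) : f = 0 := by
  by_contra hf
  obtain ⟨s, h1, h2⟩ := (h.and (eventually_evalC_mul f f⁻¹)).exists
  rw [mul_inv_cancel₀ hf, evalC_one, h1, zero_mul] at h2
  exact one_ne_zero h2

variable {a b c : ℕ}

theorem eventually_evalMat_mul (A : Matrix (Fin a) (Fin b) (RatFunc ℝ))
    (B : Matrix (Fin b) (Fin c) (RatFunc ℝ)) :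
    ∀ᶠ s in Bornology.cobounded ℂ, evalMat (A * B) s = evalMat A s * evalMat B s := by
  have h1 : ∀ᶠ s in Bornology.cobounded ℂ, ∀ i k, evalC (∑ j, A i j * B j k) s =
      ∑ j, evalC (A i j * B j k) s := by
    simp only [eventually_all]
    exact fun i k => eventually_evalC_sum _ _
  have h2 : ∀ᶠ s in Bornology.cobounded ℂ, ∀ i k j, evalC (A i j * B j k) s =
      evalC (A i j) s * evalC (B j k) s := by
    simp only [eventually_all]
    exact fun i k j => eventually_evalC_mul _ _
  filter_upwards [h1, h2] with s h1 h2
  ext i k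
  rw [Matrix.mul_apply]
  refine (h1 i k).trans (Finset.sum_congr rfl fun j _ => h2 i k j)

theorem eventually_evalVec_mulVec (A : Matrix (Fin a) (Fin b) (RatFunc ℝ))
    (v : Fin b → RatFunc ℝ) :
    ∀ᶠ s in Bornology.cobounded ℂ, evalVec (A.mulVec v) s = (evalMat A s).mulVec (evalVec v s) := by
  filter_upwards [eventually_evalMat_mul A (Matrix.of fun j (_ : Fin 1) => v j)] with s h
  ext i
  exact congrFun (congrFun h i) 0

theorem eventually_evalMat_neg (A : Matrix (Fin a) (Fin b) (RatFunc ℝ)) :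
    ∀ᶠ s in Bornology.cobounded ℂ, evalMat (-A) s = -evalMat A s := by
  have h1 : ∀ᶠ s in Bornology.cobounded ℂ, ∀ i j, evalC (-A i j) s = -evalC (A i j) s := by
    simp only [eventually_all]
    exact fun i j => eventually_evalC_neg _
  filter_upwards [h1] with s h
  ext i j
  exact h i j

theorem eventually_evalMat_X_smul (A : Matrix (Fin a) (Fin b) (RatFunc ℝ)) :
    ∀ᶠ s in Bornology.cobounded ℂ, evalMat ((RatFunc.X : RatFunc ℝ) • A) s = s • evalMat A s := by
  have h1 : ∀ᶠ s in Bornology.cobounded ℂ, ∀ i j, evalC (RatFunc.X * A i j) s =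
      evalC RatFunc.X s * evalC (A i j) s := by
    simp only [eventually_all]
    exact fun i j => eventually_evalC_mul _ _
  filter_upwards [h1] with s h
  ext i j
  refine (h i j).trans ?_
  rw [evalC_X]
  rfl

theorem evalMat_one (s : ℂ) : evalMat (1 : Matrix (Fin a) (Fin a) (RatFunc ℝ)) s = 1 :=
  Matrix.map_one _ (evalC_zero s) (evalC_one s)

/-- The rational matrix `A` tends to the real matrix `A₀` at infinity. -/
def LimitAtInfinity (A : Matrix (Fin a) (Fin b) (RatFunc ℝ)) (A₀ : Matrix (Fin a) (Fin b) ℝ) :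
    Prop :=
  Tendsto (evalMat A) (Bornology.cobounded ℂ) (𝓝 (A₀.map fun x : ℝ => (x : ℂ)))

theorem limitAtInfinity_iff {A : Matrix (Fin a) (Fin b) (RatFunc ℝ)}
    {A₀ : Matrix (Fin a) (Fin b) ℝ} : LimitAtInfinity A A₀ ↔
      ∀ i j, Tendsto (evalC (A i j)) (Bornology.cobounded ℂ) (𝓝 ((A₀ i j : ℝ) : ℂ)) := by
  unfold LimitAtInfinity
  refine tendsto_pi_nhds.trans (forall_congr' fun i => tendsto_pi_nhds)

theorem LimitAtInfinity.mul {A : Matrix (Fin a) (Fin b) (RatFunc ℝ)}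
    {B : Matrix (Fin b) (Fin c) (RatFunc ℝ)} {A₀ : Matrix (Fin a) (Fin b) ℝ}
    {B₀ : Matrix (Fin b) (Fin c) ℝ} (hA : LimitAtInfinity A A₀) (hB : LimitAtInfinity B B₀) :
    LimitAtInfinity (A * B) (A₀ * B₀) := by
  rw [limitAtInfinity_iff] at hA hB ⊢
  intro i k
  have h1 : Tendsto (fun s => ∑ j, evalC (A i j) s * evalC (B j k) s) (Bornology.cobounded ℂ)
      (𝓝 (((A₀ * B₀) i k : ℝ) : ℂ)) := by
    rw [Matrix.mul_apply, Complex.ofReal_sum]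
    simp only [Complex.ofReal_mul]
    exact tendsto_finsetSum _ fun j _ => (hA i j).mul (hB j k)
  refine h1.congr' ?_
  filter_upwards [eventually_evalMat_mul A B] with s hs
  exact (congrFun (congrFun hs i) k).symm

theorem LimitAtInfinity.neg {A : Matrix (Fin a) (Fin b) (RatFunc ℝ)}
    {A₀ : Matrix (Fin a) (Fin b) ℝ} (hA : LimitAtInfinity A A₀) : LimitAtInfinity (-A) (-A₀) := by
  rw [limitAtInfinity_iff] at hA ⊢
  intro i j
  have := (hA i j).neg
  rw [← Complex.ofReal_neg] at this
  refine this.congr' ?_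
  filter_upwards [eventually_evalC_neg (A i j)] with s hs using hs.symm

theorem det_map_ofReal_ne_zero {A₀ : Matrix (Fin a) (Fin a) ℝ} (h : IsUnit A₀.det) :
    (A₀.map fun x : ℝ => (x : ℂ)).det ≠ 0 := by
  have := RingHom.map_det Complex.ofRealHom A₀
  rw [show (A₀.map fun x : ℝ => (x : ℂ)) = Complex.ofRealHom.mapMatrix A₀ from rfl, ← this]
  simpa using h.ne_zero

theorem LimitAtInfinity.eventually_det_ne_zero {A : Matrix (Fin a) (Fin a) (RatFunc ℝ)}
    {A₀ : Matrix (Fin a) (Fin a) ℝ} (hA : LimitAtInfinity A A₀) (h : IsUnit A₀.det) :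
    ∀ᶠ s in Bornology.cobounded ℂ, (evalMat A s).det ≠ 0 :=
  ((continuous_id.matrix_det.tendsto _).comp hA).eventually
    (isOpen_ne.mem_nhds (det_map_ofReal_ne_zero h))

/-- For large `s` a kernel vector over the rational functions evaluates into the kernel of an
invertible complex matrix, so all its entries vanish near infinity and are zero. -/
theorem LimitAtInfinity.isUnit_det {A : Matrix (Fin a) (Fin a) (RatFunc ℝ)}
    {A₀ : Matrix (Fin a) (Fin a) ℝ} (hA : LimitAtInfinity A A₀) (h : IsUnit A₀.det) :
    IsUnit A.det := by
  rw [isUnit_iff_ne_zero]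
  intro h0
  obtain ⟨v, hv, hAv⟩ := Matrix.exists_mulVec_eq_zero_iff.2 h0
  refine hv (funext fun i => eq_zero_of_eventually_evalC ?_)
  filter_upwards [hA.eventually_det_ne_zero h, eventually_evalVec_mulVec A v] with s h1 h2
  rw [hAv] at h2
  have h3 : evalVec (0 : Fin a → RatFunc ℝ) s = 0 := funext fun i => evalC_zero s
  exact congrFun (Matrix.eq_zero_of_mulVec_eq_zero h1 (h2.symm.trans h3)) i

theorem eventually_evalMat_mul_inv {A : Matrix (Fin a) (Fin a) (RatFunc ℝ)} (h : IsUnit A.det) :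
    ∀ᶠ s in Bornology.cobounded ℂ, evalMat A s * evalMat A⁻¹ s = 1 := by
  filter_upwards [eventually_evalMat_mul A A⁻¹] with s hs
  rw [← hs, Matrix.mul_nonsing_inv A h, evalMat_one]

theorem LimitAtInfinity.inv {A : Matrix (Fin a) (Fin a) (RatFunc ℝ)}
    {A₀ : Matrix (Fin a) (Fin a) ℝ} (hA : LimitAtInfinity A A₀) (h : IsUnit A₀.det) :
    LimitAtInfinity A⁻¹ A₀⁻¹ := by
  have h0 := det_map_ofReal_ne_zero h
  have h1 : (A₀⁻¹).map (fun x : ℝ => (x : ℂ)) = (A₀.map fun x : ℝ => (x : ℂ))⁻¹ := by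
    refine (Matrix.inv_eq_right_inv ?_).symm
    have := Matrix.map_mul (L := A₀) (M := A₀⁻¹) (f := Complex.ofRealHom)
    rw [Matrix.mul_nonsing_inv A₀ h, Matrix.map_one _ (map_zero _) (map_one _)] at this
    exact this.symm
  have h2 : Tendsto (fun s => (evalMat A s)⁻¹) (Bornology.cobounded ℂ)
      (𝓝 (A₀.map fun x : ℝ => (x : ℂ))⁻¹) := by
    simp only [Matrix.inv_def, Ring.inverse_eq_inv']
    exact (((continuous_id.matrix_det.tendsto _).comp hA).inv₀ h0).smul
      ((continuous_id.matrix_adjugate.tendsto _).comp hA)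
  unfold LimitAtInfinity
  rw [h1]
  refine h2.congr' ?_
  filter_upwards [eventually_evalMat_mul_inv (hA.isUnit_det h)] with s hs
  exact Matrix.inv_eq_right_inv hs

/-! ### Vector signals -/

/-- The vector signal `u` has the Laplace transform `U` on some right half-plane. -/
def HasLaplaceVec (u : ℝ → Fin a → ℝ) (U : ℂ → Fin a → ℂ) : Prop :=
  ∀ i, HasLaplace (fun t => u t i) (fun s => U s i)

theorem hasLaplaceVec_iff {u : ℝ → Fin a → ℝ} {U : ℂ → Fin a → ℂ} :
    HasLaplaceVec u U ↔
      LaplaceTransformableVec u ∧ ∀ᶠ s in rightHalfPlanes, laplaceVec u s = U s := by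
  simp only [HasLaplaceVec, HasLaplace, forall_and, ← eventually_all, funext_iff,
    LaplaceTransformableVec, laplaceVec]

theorem LaplaceTransformableVec.hasLaplaceVec {u : ℝ → Fin a → ℝ}
    (hu : LaplaceTransformableVec u) : HasLaplaceVec u (laplaceVec u) :=
  fun i => (hu i).hasLaplace

theorem HasLaplaceVec.add {u v : ℝ → Fin a → ℝ} {U V : ℂ → Fin a → ℂ} (hu : HasLaplaceVec u U)
    (hv : HasLaplaceVec v V) : HasLaplaceVec (u + v) (U + V) := fun i => (hu i).add (hv i)

theorem HasLaplaceVec.sub {u v : ℝ → Fin a → ℝ} {U V : ℂ → Fin a → ℂ} (hu : HasLaplaceVec u U)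
    (hv : HasLaplaceVec v V) : HasLaplaceVec (u - v) (U - V) := fun i => (hu i).sub (hv i)

theorem HasLaplaceVec.congr {u : ℝ → Fin a → ℝ} {U V : ℂ → Fin a → ℂ} (hu : HasLaplaceVec u U)
    (h : U =ᶠ[rightHalfPlanes] V) : HasLaplaceVec u V :=
  fun i => (hu i).congr (h.mono fun _ hs => congrFun hs i)

theorem HasLaplaceVec.ae_eq {u v : ℝ → Fin a → ℝ} {U : ℂ → Fin a → ℂ} (hu : HasLaplaceVec u U)
    (hv : HasLaplaceVec v U) : u =ᵐ[volume.restrict (Ioi 0)] v := by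
  have := eventually_all.2 fun i => (hu i).ae_eq (hv i)
  filter_upwards [this] with t ht
  exact funext ht

/-- The operator `u ↦ A₀ u + κ * u` with feedthrough matrix `A₀` and convolution kernel `κ`. -/
noncomputable def convOp (A₀ : Matrix (Fin a) (Fin b) ℝ) (κ : Fin a → Fin b → ℝ → ℝ)
    (u : ℝ → Fin b → ℝ) (t : ℝ) : Fin a → ℝ :=
  fun i => ∑ j, (A₀ i j * u t j + conv (κ i j) (fun τ => u τ j) t)

/-- The entries of `A - A₀` vanish at infinity and have continuous inverse transforms; these form
the kernel, while `A₀` acts by plain multiplication. -/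
theorem LimitAtInfinity.exists_convOp {A : Matrix (Fin a) (Fin b) (RatFunc ℝ)}
    {A₀ : Matrix (Fin a) (Fin b) ℝ} (hA : LimitAtInfinity A A₀) :
    ∃ κ : Fin a → Fin b → ℝ → ℝ, (∀ i j, Continuous (κ i j)) ∧
      ∀ u U, HasLaplaceVec u U →
        HasLaplaceVec (convOp A₀ κ u) (fun s => (evalMat A s).mulVec (U s)) := by
  rw [limitAtInfinity_iff] at hA
  have hsub : ∀ i j, ∀ᶠ s in Bornology.cobounded ℂ,
      evalC (A i j - RatFunc.C (A₀ i j)) s = evalC (A i j) s - (A₀ i j : ℝ) := by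
    intro i j
    filter_upwards [eventually_evalC_sub (A i j) (RatFunc.C (A₀ i j))] with s hs
    rw [hs, evalC_C]
  have h1 : ∀ i j, Tendsto (evalC (A i j - RatFunc.C (A₀ i j))) (Bornology.cobounded ℂ) (𝓝 0) := by
    intro i j
    have := (hA i j).sub_const ((A₀ i j : ℝ) : ℂ)
    rw [sub_self] at this
    refine this.congr' ?_
    filter_upwards [hsub i j] with s hs using hs.symm
  choose κ hκ hκ' hκ'' using fun i j => exists_inverseLaplace _ (h1 i j)
  refine ⟨κ, hκ, fun u U hu i => ?_⟩
  refine (HasLaplace.sum Finset.univ fun j _ =>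
    ((hu j).const_mul (A₀ i j)).add ((hκ' i j).conv (hu j))).congr ?_
  have h2 : ∀ᶠ s in rightHalfPlanes, ∀ j,
      evalC (A i j - RatFunc.C (A₀ i j)) s = evalC (A i j) s - (A₀ i j : ℝ) :=
    eventually_all.2 fun j => (hsub i j).filter_mono rightHalfPlanes_le_cobounded
  filter_upwards [h2] with s hs
  refine Finset.sum_congr rfl fun j _ => ?_
  rw [hs j]
  simp only [evalMat, Matrix.map_apply]
  ring

variable {κ : Fin a → Fin b → ℝ → ℝ} {A₀ : Matrix (Fin a) (Fin b) ℝ} {T : ℝ}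

theorem continuousOn_convOp (hκ : ∀ i j, Continuous (κ i j)) {u : ℝ → Fin b → ℝ}
    (hu : ContinuousOn u (Icc 0 T)) : ContinuousOn (convOp A₀ κ u) (Icc 0 T) := by
  rw [continuousOn_pi] at hu ⊢
  intro i
  refine continuousOn_finsetSum _ fun j _ => ((hu j).const_mul _).add (continuousOn_conv (hκ i j) ?_)
  exact (hu j).integrableOn_Icc.mono_set Ioc_subset_Icc_self

theorem continuousOn_convOp_zero (hκ : ∀ i j, Continuous (κ i j)) {u : ℝ → Fin b → ℝ}
    (hu : LaplaceTransformableVec u) : ContinuousOn (convOp 0 κ u) (Icc 0 T) := by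
  rw [continuousOn_pi]
  intro i
  refine continuousOn_finsetSum _ fun j _ => ?_
  simp only [Matrix.zero_apply, zero_mul, zero_add]
  exact continuousOn_conv (hκ i j) ((hu j).integrableOn_Ioc T)

theorem convOp_zero_apply_zero (u : ℝ → Fin b → ℝ) : convOp 0 κ u 0 = 0 := by
  funext i
  simp [convOp, conv_zero_right]

/-- Causality: the output at time `t` involves the input only up to time `t`. -/
theorem convOp_congr_ae {u v : ℝ → Fin b → ℝ} (h : u =ᵐ[volume.restrict (Icc 0 T)] v) :
    convOp A₀ κ u =ᵐ[volume.restrict (Icc 0 T)] convOp A₀ κ v := by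
  filter_upwards [h, ae_restrict_mem measurableSet_Icc] with t ht htT
  funext i
  refine Finset.sum_congr rfl fun j _ => ?_
  rw [ht]
  congr 1
  refine conv_congr_ae ?_ htT
  filter_upwards [h] with τ hτ using congrFun hτ j

theorem IsContinuousSignal.convOp (hκ : ∀ i j, Continuous (κ i j)) {u : ℝ → Fin b → ℝ}
    (hu : IsContinuousSignal T u) : IsContinuousSignal T (convOp A₀ κ u) := by
  obtain ⟨g, hg, hug⟩ := hu
  exact ⟨_, continuousOn_convOp hκ hg, convOp_congr_ae hug⟩

theorem IsContinuousSignal.add {u v : ℝ → Fin a → ℝ} (hu : IsContinuousSignal T u)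
    (hv : IsContinuousSignal T v) : IsContinuousSignal T (u + v) := by
  obtain ⟨g, hg, hug⟩ := hu
  obtain ⟨k, hk, hvk⟩ := hv
  exact ⟨g + k, hg.add hk, hug.add hvk⟩

theorem IsContinuousSignal.congr_ae {u v : ℝ → Fin a → ℝ} (hu : IsContinuousSignal T u)
    (h : u =ᵐ[volume.restrict (Icc 0 T)] v) : IsContinuousSignal T v := by
  obtain ⟨g, hg, hug⟩ := hu
  exact ⟨g, hg, h.symm.trans hug⟩


/-! ### Continuously differentiable signals -/

theorem laplaceTransformable_of_bounded {f : ℝ → ℝ} (hf : Continuous f) {C : ℝ}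
    (hC : ∀ t, |f t| ≤ C) : LaplaceTransformable f := by
  refine ⟨1, ?_⟩
  refine Integrable.mono' (g := fun t => C * Real.exp (-t))
    ((integrableOn_exp_neg_Ioi 0).const_mul C) ?_ (Eventually.of_forall fun t => ?_)
  · exact ((by fun_prop : Continuous fun t : ℝ => Real.exp (-1 * t)).mul hf).aestronglyMeasurable
  · rw [norm_mul, Real.norm_eq_abs, Real.norm_eq_abs, Real.abs_exp, mul_comm, neg_one_mul]
    exact mul_le_mul_of_nonneg_right (hC t) (Real.exp_pos _).le

theorem conv_one_apply (u : ℝ → ℝ) (t : ℝ) : conv (fun _ => 1) u t = ∫ τ in (0 : ℝ)..t, u τ := by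
  simp [conv]

theorem HasLaplace.integral {u : ℝ → ℝ} {U : ℂ → ℂ} (hu : HasLaplace u U) :
    HasLaplace (ILC.conv (fun _ => 1) u) (fun s => s⁻¹ * U s) := by
  simpa using (hasLaplace_const 1).conv hu

theorem eventually_ne_zero_rightHalfPlanes : ∀ᶠ s in rightHalfPlanes, s ≠ 0 :=
  (Bornology.eventually_ne_cobounded (0 : ℂ)).filter_mono rightHalfPlanes_le_cobounded

variable {q : ℕ} {T : ℝ}

theorem sub_eq_integral_derivWithin {y : ℝ → Fin q → ℝ} {S : Set ℝ} (hS : UniqueDiffOn ℝ S)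
    (hSc : S.OrdConnected) (hy : ContDiffOn ℝ 1 y S) {x t : ℝ} (hx : x ∈ S) (ht : t ∈ S)
    (hxt : x ≤ t) (i : Fin q) :
    ∫ τ in x..t, derivWithin y S τ i = y t i - y x i := by
  have hsub : Icc x t ⊆ S := hSc.out hx ht
  have hd : ContinuousOn (derivWithin y S) S := hy.continuousOn_derivWithin hS le_rfl
  refine intervalIntegral.integral_eq_sub_of_hasDeriv_right_of_le hxt
    (f := fun τ => y τ i) ?_ ?_ ?_
  · exact (continuousOn_pi.1 (hy.continuousOn.mono hsub) i)
  · intro τ hτ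
    have h1 : HasDerivWithinAt y (derivWithin y S τ) S τ :=
      ((hy.differentiableOn one_ne_zero) τ (hsub (Ioo_subset_Icc_self hτ))).hasDerivWithinAt
    have h2 := hasDerivWithinAt_pi.1 h1 i
    have h3 : S ∈ 𝓝[Ioi τ] τ :=
      mem_nhdsWithin_of_mem_nhds (mem_of_superset (Icc_mem_nhds hτ.1 hτ.2) hsub)
    exact h2.mono_of_mem_nhdsWithin h3
  · exact ((continuousOn_pi.1 (hd.mono hsub) i)).intervalIntegrable_of_Icc hxt

/-- Transforming `y(t) = y(0) + ∫₀ᵗ y'` avoids the boundary term at infinity of an integration by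
parts. -/
theorem hasLaplaceVec_derivWithin {y : ℝ → Fin q → ℝ} (hy : ContDiffOn ℝ 1 y (Ici 0))
    {Y : ℂ → Fin q → ℂ} (hY : HasLaplaceVec y Y)
    (hv : LaplaceTransformableVec (derivWithin y (Ici 0))) :
    HasLaplaceVec (derivWithin y (Ici 0)) (fun s i => s * Y s i - (y 0 i : ℝ)) := by
  intro i
  have h1 := ((hasLaplace_const (y 0 i)).add (hv i).hasLaplace.integral).congr_ae (g := fun t => y t i) (by
    refine (ae_restrict_iff' measurableSet_Ioi).2 (Eventually.of_forall fun t ht => ?_)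
    have ht : 0 < t := ht
    beta_reduce
    rw [conv_one_apply, sub_eq_integral_derivWithin (uniqueDiffOn_Ici 0) ordConnected_Ici hy
      self_mem_Ici ht.le ht.le]
    ring)
  refine (hv i).hasLaplace.congr ?_
  filter_upwards [h1.2, (hY i).2, eventually_ne_zero_rightHalfPlanes] with s h2 h3 hs
  rw [← h3, h2]
  field_simp
  ring

/-- Freezing the derivative at its endpoint values outside `[0, T]` gives a bounded continuous
function; its integral is the continuation. -/
theorem exists_isRegularContinuation (hT' : 0 < T) {yd : ℝ → Fin q → ℝ}
    (hyd : ContDiffOn ℝ 1 yd (Icc 0 T)) : ∃ y, IsRegularContinuation T yd y := by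
  have hT := hT'.le
  set w := derivWithin yd (Icc 0 T) with hw
  have hwc : ContinuousOn w (Icc 0 T) :=
    hyd.continuousOn_derivWithin (uniqueDiffOn_Icc hT') le_rfl
  set v : ℝ → Fin q → ℝ := fun t => w (projIcc 0 T hT t) with hv
  have hvc : Continuous v := by
    refine hwc.comp_continuous (continuous_subtype_val.comp continuous_projIcc) fun t => ?_
    exact (projIcc 0 T hT t).2
  have hvw : EqOn v w (Icc 0 T) := fun t ht => by simp [hv, projIcc_of_mem hT ht]
  obtain ⟨C, hC⟩ := isCompact_Icc.exists_bound_of_continuousOn hwc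
  have hvlt : ∀ i, LaplaceTransformable fun t => v t i := fun i =>
    laplaceTransformable_of_bounded (continuous_pi_iff.1 hvc i) (C := C) fun t =>
      (norm_le_pi_norm (v t) i).trans (hC _ (projIcc 0 T hT t).2)
  set y : ℝ → Fin q → ℝ := fun t i => yd 0 i + ∫ τ in (0 : ℝ)..t, v τ i with hy
  have hyderiv : ∀ t, HasDerivAt y (v t) t := by
    intro t
    rw [hasDerivAt_pi]
    intro i
    exact ((continuous_pi_iff.1 hvc i).integral_hasStrictDerivAt 0 t).hasDerivAt.const_add _
  have hdw : EqOn (derivWithin y (Ici 0)) v (Ici 0) := fun t ht =>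
    (hyderiv t).hasDerivWithinAt.derivWithin (uniqueDiffOn_Ici 0 t ht)
  refine ⟨y, ⟨fun i => ?_, fun t ht => ?_⟩, ?_, fun i => ?_⟩
  · have h := ((hasLaplace_const (yd 0 i)).add (hvlt i).hasLaplace.integral).1
    simpa only [conv_one_apply] using h
  · funext i
    have h1 : ∫ τ in (0 : ℝ)..t, v τ i = ∫ τ in (0 : ℝ)..t, w τ i := by
      refine intervalIntegral.integral_congr fun τ hτ => ?_
      rw [uIcc_of_le ht.1] at hτ
      simp only [hvw ⟨hτ.1, hτ.2.trans ht.2⟩]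
    simp only [hy]
    rw [h1, sub_eq_integral_derivWithin (uniqueDiffOn_Icc hT') ordConnected_Icc hyd
      (left_mem_Icc.2 hT) ht ht.1]
    ring
  · refine ContDiff.contDiffOn (contDiff_one_iff_deriv.2
      ⟨fun t => (hyderiv t).differentiableAt, ?_⟩)
    rw [show deriv y = v from funext fun t => (hyderiv t).deriv]
    exact hvc
  · refine ((hvlt i).hasLaplace.congr_ae ?_).1
    refine (ae_restrict_iff' measurableSet_Ioi).2 (Eventually.of_forall fun t ht => ?_)
    simp only
    rw [hdw (mem_Ici.2 (mem_Ioi.1 ht).le)]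

/-- A signal whose running integral vanishes on `[0, T]` vanishes almost everywhere there. -/
theorem ae_eq_zero_of_conv_one_eq_zero {w : ℝ → ℝ} (hw : LaplaceTransformable w) (hT : 0 ≤ T)
    (h : ∀ t ∈ Icc 0 T, conv (fun _ => 1) w t = 0) :
    w =ᵐ[volume.restrict (Icc 0 T)] fun _ => 0 := by
  have hw' : LaplaceTransformable ((Iic T).indicator w) := by
    obtain ⟨σ, hσ⟩ := hw
    refine ⟨σ, (hσ.indicator (measurableSet_Iic (a := T))).congr (Eventually.of_forall fun t => ?_)⟩
    by_cases ht : t ∈ Iic T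
    · simp [indicator_of_mem ht]
    · simp [indicator_of_notMem ht]
  -- After truncation the running integral stays constant beyond `T`, so it vanishes for all
  -- positive times and Lerch's theorem applies.
  have hconv : ∀ t > 0, conv (fun _ => 1) ((Iic T).indicator w) t = 0 := by
    intro t ht
    rw [← h (min t T) ⟨le_min ht.le hT, min_le_right _ _⟩, conv_one_apply, conv_one_apply,
      intervalIntegral.integral_of_le ht.le, intervalIntegral.integral_of_le (le_min ht.le hT),
      setIntegral_indicator measurableSet_Iic, Ioc_inter_Iic]
  have h1 : HasLaplace (fun _ => 0) fun s => s⁻¹ * laplace ((Iic T).indicator w) s :=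
    hw'.hasLaplace.integral.congr_ae
      ((ae_restrict_iff' measurableSet_Ioi).2 (Eventually.of_forall hconv))
  have h2 : HasLaplace ((Iic T).indicator w) fun _ => 0 := by
    refine hw'.hasLaplace.congr ?_
    filter_upwards [h1.2, eventually_ne_zero_rightHalfPlanes] with s hs hs0
    have : laplace (fun _ => 0) s = 0 := by simp [laplace]
    rw [this] at hs
    exact (mul_eq_zero.1 hs.symm).resolve_left (inv_ne_zero hs0)
  filter_upwards [ae_restrict_Icc_of_Ioi (T := T) h2.ae_eq_zero, ae_restrict_mem measurableSet_Icc]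
    with t ht htT
  rwa [indicator_of_mem (show t ∈ Iic T from htT.2)] at ht

/-! ### Strictly proper systems and their inverses -/

theorem eq_on_Icc_of_hasLaplaceVec (hT : 0 < T) {f g : ℝ → Fin q → ℝ} {F : ℂ → Fin q → ℂ}
    (hf : HasLaplaceVec f F) (hg : HasLaplaceVec g F) (hfc : ContinuousOn f (Icc 0 T))
    (hgc : ContinuousOn g (Icc 0 T)) : EqOn f g (Icc 0 T) :=
  Measure.eqOn_Icc_of_ae_eq volume hT.ne (ae_restrict_Icc_of_Ioi (hf.ae_eq hg)) hfc hgc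

/-- The response `κ * u + ψ` is continuous even for a merely transformable `u`, so it agrees with
`y` everywhere on `[0, T]`, in particular at `0`, where the convolution vanishes. -/
theorem LimitAtInfinity.output_zero {p : ℕ} {G : Matrix (Fin q) (Fin p) (RatFunc ℝ)}
    (hG : LimitAtInfinity G 0) (hT : 0 < T) {ψ : ℝ → Fin q → ℝ} (hψc : Continuous ψ)
    {Ψ : ℂ → Fin q → ℂ} (hψ : HasLaplaceVec ψ Ψ) {u : ℝ → Fin p → ℝ} {U : ℂ → Fin p → ℂ}
    (hu : HasLaplaceVec u U) {y : ℝ → Fin q → ℝ}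
    (hy : HasLaplaceVec y fun s => (evalMat G s).mulVec (U s) + Ψ s)
    (hyc : ContinuousOn y (Icc 0 T)) : y 0 = ψ 0 := by
  obtain ⟨κ, hκ, hop⟩ := hG.exists_convOp
  have h := eq_on_Icc_of_hasLaplaceVec hT hy ((hop u U hu).add hψ) hyc
    ((continuousOn_convOp_zero hκ (hasLaplaceVec_iff.1 hu).1).add hψc.continuousOn)
    (left_mem_Icc.2 hT.le)
  rw [h, Pi.add_apply, convOp_zero_apply_zero, zero_add]

section Inverse

variable {A : Matrix (Fin q) (Fin q) (RatFunc ℝ)} {M : Matrix (Fin q) (Fin q) ℝ}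

theorem isUnit_det_of_X_smul (hA : IsUnit ((RatFunc.X : RatFunc ℝ) • A).det) : IsUnit A.det := by
  rw [Matrix.det_smul] at hA
  exact isUnit_of_mul_isUnit_right hA

theorem eventually_evalMat_inv_X_smul (hA : IsUnit ((RatFunc.X : RatFunc ℝ) • A).det) :
    ∀ᶠ s in Bornology.cobounded ℂ,
      evalMat ((RatFunc.X : RatFunc ℝ) • A)⁻¹ s = s⁻¹ • evalMat A⁻¹ s := by
  filter_upwards [eventually_evalMat_mul_inv hA,
    eventually_evalMat_mul_inv (isUnit_det_of_X_smul hA), eventually_evalMat_X_smul A,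
    Bornology.eventually_ne_cobounded (0 : ℂ)] with s h1 h2 h3 hs
  have h4 : evalMat ((RatFunc.X : RatFunc ℝ) • A) s * (s⁻¹ • evalMat A⁻¹ s) = 1 := by
    rw [h3, smul_mul_smul_comm, h2, mul_inv_cancel₀ hs, one_smul]
  rw [← Matrix.inv_eq_right_inv h1, Matrix.inv_eq_right_inv h4]

variable (hA : LimitAtInfinity ((RatFunc.X : RatFunc ℝ) • A) M) (hM : IsUnit M.det)
include hA hM

/-- The inverse of a system of relative degree one applied to a signal with a Laplace transformable
derivative. -/
theorem LimitAtInfinity.exists_inverse_signal {v : ℝ → Fin q → ℝ} {G : ℂ → Fin q → ℂ}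
    (hv : HasLaplaceVec v fun s => s • G s) (hvc : ContinuousOn v (Icc 0 T)) :
    ∃ w, HasLaplaceVec w (fun s => (evalMat A⁻¹ s).mulVec (G s)) ∧ ContinuousOn w (Icc 0 T) := by
  obtain ⟨κ, hκ, hop⟩ := (hA.inv hM).exists_convOp
  refine ⟨_, (hop v _ hv).congr ?_, continuousOn_convOp hκ hvc⟩
  filter_upwards [(eventually_evalMat_inv_X_smul (hA.isUnit_det hM)).filter_mono
    rightHalfPlanes_le_cobounded, eventually_ne_zero_rightHalfPlanes] with s hs hs0
  rw [hs, Matrix.smul_mulVec, Matrix.mulVec_smul, smul_smul, inv_mul_cancel₀ hs0, one_smul]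

/-- The inverse of a system of relative degree one is causal. -/
theorem LimitAtInfinity.inverse_ae_eq_zero (hT : 0 < T) {g w : ℝ → Fin q → ℝ} {G : ℂ → Fin q → ℂ}
    (hg : HasLaplaceVec g G) (hw : HasLaplaceVec w fun s => (evalMat A⁻¹ s).mulVec (G s))
    (hg0 : g =ᵐ[volume.restrict (Icc 0 T)] 0) : w =ᵐ[volume.restrict (Icc 0 T)] 0 := by
  obtain ⟨κ, hκ, hop⟩ := (hA.inv hM).exists_convOp
  -- `A⁻¹` itself need not be proper, but `s⁻¹ A⁻¹ = (s A)⁻¹` is. So causality is proved for the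
  -- running integral of `w` and then passed on to `w`.
  set r : ℝ → Fin q → ℝ := fun t i => conv (fun _ => 1) (fun τ => w τ i) t with hr
  have hrL : HasLaplaceVec r fun s i => s⁻¹ * (evalMat A⁻¹ s).mulVec (G s) i :=
    fun i => (hw i).integral
  have hopL := (hop g G hg).congr (V := fun s i => s⁻¹ * (evalMat A⁻¹ s).mulVec (G s) i) (by
    filter_upwards [(eventually_evalMat_inv_X_smul (hA.isUnit_det hM)).filter_mono
      rightHalfPlanes_le_cobounded] with s hs
    rw [hs, Matrix.smul_mulVec]
    rfl)
  have h0 : convOp M⁻¹ κ (0 : ℝ → Fin q → ℝ) = 0 := by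
    funext t i
    simp [convOp, conv]
  have h1 : r =ᵐ[volume.restrict (Icc 0 T)] 0 := by
    have := convOp_congr_ae (A₀ := M⁻¹) (κ := κ) hg0
    rw [h0] at this
    exact EventuallyEq.trans (ae_restrict_Icc_of_Ioi (hrL.ae_eq hopL)) this
  have hrc : ContinuousOn r (Icc 0 T) := continuousOn_pi.2 fun i =>
    continuousOn_conv continuous_const ((hw i).1.integrableOn_Ioc T)
  have h2 : EqOn r 0 (Icc 0 T) :=
    Measure.eqOn_Icc_of_ae_eq volume hT.ne h1 hrc continuousOn_const
  have h3 : ∀ i, (fun t => w t i) =ᵐ[volume.restrict (Icc 0 T)] fun _ => 0 := fun i =>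
    ae_eq_zero_of_conv_one_eq_zero (hw i).1 hT.le fun t ht => congrFun (h2 ht) i
  filter_upwards [eventually_all.2 h3] with t ht using funext ht

end Inverse

/-! ### Blocks -/

section Blocks

variable {p : ℕ} (h : q ≤ p)

/-- The index of the `j`-th entry of the lower block. -/
def lowerIndex (j : Fin (p - q)) : Fin p := Fin.cast (Nat.add_sub_cancel' h) (Fin.natAdd q j)

theorem stack_castLE {R : Type*} (v : Fin q → R) (w : Fin (p - q) → R) (i : Fin q) :
    stack h v w (Fin.castLE h i) = v i :=
  Fin.append_left v w i

theorem stack_lowerIndex {R : Type*} (v : Fin q → R) (w : Fin (p - q) → R) (j : Fin (p - q)) :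
    stack h v w (lowerIndex h j) = w j :=
  Fin.append_right v w j

theorem forall_index_of_blocks {P : Fin p → Prop} (h₁ : ∀ i, P (Fin.castLE h i))
    (h₂ : ∀ j, P (lowerIndex h j)) (j : Fin p) : P j := by
  have : ∀ k : Fin (q + (p - q)), P (Fin.cast (Nat.add_sub_cancel' h) k) :=
    Fin.addCases h₁ h₂
  exact this (Fin.cast (Nat.add_sub_cancel' h).symm j)

theorem eq_stack_iff {R : Type*} {x : Fin p → R} {v : Fin q → R} {w : Fin (p - q) → R} :
    x = stack h v w ↔ (fun i => x (Fin.castLE h i)) = v ∧ (fun j => x (lowerIndex h j)) = w := by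
  constructor
  · rintro rfl
    exact ⟨funext fun i => stack_castLE h v w i, funext fun j => stack_lowerIndex h v w j⟩
  · rintro ⟨rfl, rfl⟩
    refine funext (forall_index_of_blocks h (fun i => ?_) fun j => ?_)
    · rw [stack_castLE]
    · rw [stack_lowerIndex]

theorem stack_add_stack {R : Type*} [Add R] (v v' : Fin q → R) (w w' : Fin (p - q) → R) :
    stack h v w + stack h v' w' = stack h (v + v') (w + w') := by
  refine (eq_stack_iff h).2 ⟨funext fun i => ?_, funext fun j => ?_⟩
  · simp [stack_castLE]
  · simp [stack_lowerIndex]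

theorem mulVec_stack {R : Type*} [NonUnitalNonAssocSemiring R] (M : Matrix (Fin q) (Fin p) R)
    (v : Fin q → R) (w : Fin (p - q) → R) :
    M.mulVec (stack h v w) = (leftBlock h M).mulVec v + (rightBlock h M).mulVec w := by
  funext i
  simp only [Matrix.mulVec, dotProduct, Pi.add_apply]
  rw [← Equiv.sum_comp (finCongr (Nat.add_sub_cancel' h)), Fin.sum_univ_add]
  congr 1
  · exact Finset.sum_congr rfl fun j _ => congrArg (M i (Fin.castLE h j) * ·) (stack_castLE h v w j)
  · exact Finset.sum_congr rfl fun j _ => congrArg (M i (lowerIndex h j) * ·) (stack_lowerIndex h v w j)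

theorem HasLaplaceVec.stack {v : ℝ → Fin q → ℝ} {V : ℂ → Fin q → ℂ} {w : ℝ → Fin (p - q) → ℝ}
    {W : ℂ → Fin (p - q) → ℂ} (hv : HasLaplaceVec v V) (hw : HasLaplaceVec w W) :
    HasLaplaceVec (fun t => stack h (v t) (w t)) (fun s => stack h (V s) (W s)) := by
  refine forall_index_of_blocks h (fun i => ?_) fun j => ?_
  · simpa only [stack_castLE] using hv i
  · simpa only [stack_lowerIndex] using hw j

theorem isContinuousSignal_of_blocks {u : ℝ → Fin p → ℝ}
    (h₁ : IsContinuousSignal T fun t i => u t (Fin.castLE h i))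
    (h₂ : IsContinuousSignal T fun t j => u t (lowerIndex h j)) : IsContinuousSignal T u := by
  obtain ⟨g, hg, hug⟩ := h₁
  obtain ⟨k, hk, huk⟩ := h₂
  refine ⟨fun t => stack h (g t) (k t), continuousOn_pi.2 (forall_index_of_blocks h
    (fun i => ?_) fun j => ?_), ?_⟩
  · simpa only [stack_castLE] using continuousOn_pi.1 hg i
  · simpa only [stack_lowerIndex] using continuousOn_pi.1 hk j
  · filter_upwards [hug, huk] with t h1 h2 using (eq_stack_iff h).2 ⟨h1, h2⟩

theorem IsContinuousSignal.comp_index {n k : ℕ} {u : ℝ → Fin n → ℝ} (hu : IsContinuousSignal T u)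
    (e : Fin k → Fin n) : IsContinuousSignal T fun t j => u t (e j) := by
  obtain ⟨g, hg, hug⟩ := hu
  refine ⟨fun t j => g t (e j), continuousOn_pi.2 fun j => continuousOn_pi.1 hg (e j), ?_⟩
  filter_upwards [hug] with t ht
  rw [ht]

/-- Solving `G₁ U = R` for the upper block of `U`. -/
theorem eventually_mulVec_stack_eq_iff {G₁ : Matrix (Fin q) (Fin p) (RatFunc ℝ)}
    (hG : IsUnit (leftBlock h G₁).det) :
    ∀ᶠ s in rightHalfPlanes, ∀ (v : Fin q → ℂ) (w : Fin (p - q) → ℂ) (r : Fin q → ℂ),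
      (evalMat G₁ s).mulVec (stack h v w) = r ↔
        v = (evalMat (leftBlock h G₁)⁻¹ s).mulVec r +
          (evalMat (-((leftBlock h G₁)⁻¹ * rightBlock h G₁)) s).mulVec w := by
  refine Eventually.filter_mono rightHalfPlanes_le_cobounded ?_
  filter_upwards [eventually_evalMat_mul_inv hG,
    eventually_evalMat_mul (leftBlock h G₁)⁻¹ (rightBlock h G₁),
    eventually_evalMat_neg ((leftBlock h G₁)⁻¹ * rightBlock h G₁)] with s h1 h2 h3 v w r
  have h4 := mul_eq_one_comm.1 h1
  rw [mulVec_stack, h3, h2, show leftBlock h (evalMat G₁ s) = evalMat (leftBlock h G₁) s from rfl,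
    show rightBlock h (evalMat G₁ s) = evalMat (rightBlock h G₁) s from rfl, Matrix.neg_mulVec,
    ← Matrix.mulVec_mulVec, ← sub_eq_add_neg, ← Matrix.mulVec_sub]
  constructor
  · rintro rfl
    rw [add_sub_cancel_right, Matrix.mulVec_mulVec, h4, Matrix.one_mulVec]
  · rintro rfl
    rw [Matrix.mulVec_mulVec, h1, Matrix.one_mulVec, sub_add_cancel]

end Blocks


/-! ### Initial values and the rational disturbance term -/

/-- Initial value theorem: by Lerch and continuity each entry of `Φ` coincides on `[0, 1]` with the
exponential series, whose value at `0` is the limit of `s G(s)`. -/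
theorem limitAtInfinity_X_smul_of_isInverseLaplace {a b : ℕ}
    {G : Matrix (Fin a) (Fin b) (RatFunc ℝ)} (hG : StrictlyProper G)
    {Φ : ℝ → Matrix (Fin a) (Fin b) ℝ} (hΦ : IsInverseLaplace Φ G) :
    LimitAtInfinity ((RatFunc.X : RatFunc ℝ) • G) (Φ 0) := by
  obtain ⟨hΦc, hΦt, hΦL⟩ := hΦ
  rw [limitAtInfinity_iff]
  intro i j
  have h1 : Tendsto (evalC (G i j)) (Bornology.cobounded ℂ) (𝓝 0) :=
    tendsto_pi_nhds.1 (tendsto_pi_nhds.1 hG i) j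
  obtain ⟨φ, hφc, hφ, hlim⟩ := exists_inverseLaplace _ h1
  have hL : HasLaplace (fun t => Φ t i j) (evalC (G i j)) := ⟨hΦt i j, hΦL i j⟩
  have heq : EqOn (fun t => Φ t i j) φ (Icc 0 1) :=
    Measure.eqOn_Icc_of_ae_eq volume zero_ne_one (ae_restrict_Icc_of_Ioi (hL.ae_eq hφ))
      ((continuousOn_pi.1 (continuousOn_pi.1 hΦc i) j).mono Icc_subset_Ici_self)
      hφc.continuousOn
  have h0 : Φ 0 i j = φ 0 := heq (left_mem_Icc.2 zero_le_one)
  rw [h0]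
  refine hlim.congr' ?_
  filter_upwards [eventually_evalC_mul RatFunc.X (G i j)] with s hs
  rw [evalC_X] at hs
  exact hs.symm

theorem tendsto_evalC_mulVec_of_strictlyProper {q m : ℕ} {G : Matrix (Fin q) (Fin m) (RatFunc ℝ)}
    (hG : StrictlyProper G) {D : Fin m → RatFunc ℝ} {d : Fin m → ℂ}
    (hD : Tendsto (evalVec D) (Bornology.cobounded ℂ) (𝓝 d)) (i : Fin q) :
    Tendsto (evalC (G.mulVec D i)) (Bornology.cobounded ℂ) (𝓝 0) := by
  have h1 : Tendsto (fun s => ∑ j, evalC (G i j) s * evalC (D j) s) (Bornology.cobounded ℂ)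
      (𝓝 (∑ j, 0 * d j)) :=
    tendsto_finsetSum _ fun j _ => (tendsto_pi_nhds.1 (tendsto_pi_nhds.1 hG i) j).mul
      (tendsto_pi_nhds.1 hD j)
  simp only [zero_mul, Finset.sum_const_zero] at h1
  refine h1.congr' ?_
  filter_upwards [eventually_evalVec_mulVec G D] with s hs
  exact (congrFun hs i).symm

theorem tendsto_evalVec_const_add {m : ℕ} {d₀ : Fin m → ℝ} {Dhat : Fin m → RatFunc ℝ}
    (hDhat : StrictlyProperVec Dhat) :
    Tendsto (evalVec fun i => RatFunc.C (d₀ i) + Dhat i) (Bornology.cobounded ℂ)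
      (𝓝 fun i => (d₀ i : ℂ)) := by
  refine tendsto_pi_nhds.2 fun i => ?_
  have h1 := (tendsto_pi_nhds.1 hDhat i).const_add (d₀ i : ℂ)
  rw [Pi.zero_apply, add_zero] at h1
  refine h1.congr' ?_
  filter_upwards [eventually_evalC_add (RatFunc.C (d₀ i)) (Dhat i)] with s hs
  rw [evalC_C] at hs
  exact hs.symm

/-- A vector of rational functions vanishing at infinity is the transform of a continuous signal
`ψ`, and `s Ψ(s) - ψ(0)` is the transform of a continuous signal, too. -/
theorem exists_inverseLaplaceVec {q : ℕ} {Ψ : Fin q → RatFunc ℝ}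
    (hΨ : ∀ i, Tendsto (evalC (Ψ i)) (Bornology.cobounded ℂ) (𝓝 0)) :
    ∃ ψ χ : ℝ → Fin q → ℝ, Continuous ψ ∧ Continuous χ ∧ HasLaplaceVec ψ (evalVec Ψ) ∧
      HasLaplaceVec χ fun s i => s * evalVec Ψ s i - (ψ 0 i : ℝ) := by
  choose ψ hψc hψ hlim using fun i => exists_inverseLaplace _ (hΨ i)
  have heq : ∀ i, ∀ᶠ s in Bornology.cobounded ℂ,
      evalC (RatFunc.X * Ψ i - RatFunc.C (ψ i 0)) s = s * evalC (Ψ i) s - (ψ i 0 : ℝ) := by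
    intro i
    filter_upwards [eventually_evalC_sub (RatFunc.X * Ψ i) (RatFunc.C (ψ i 0)),
      eventually_evalC_mul RatFunc.X (Ψ i)] with s h1 h2
    rw [h1, h2, evalC_X, evalC_C]
  have h2 : ∀ i, Tendsto (evalC (RatFunc.X * Ψ i - RatFunc.C (ψ i 0))) (Bornology.cobounded ℂ)
      (𝓝 0) := by
    intro i
    have h3 := (hlim i).sub_const ((ψ i 0 : ℝ) : ℂ)
    rw [sub_self] at h3
    exact h3.congr' ((heq i).mono fun _ hs => hs.symm)
  choose χ hχc hχ _ using fun i => exists_inverseLaplace _ (h2 i)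
  exact ⟨fun t i => ψ i t, fun t i => χ i t, continuous_pi hψc, continuous_pi hχc, hψ,
    fun i => (hχ i).congr ((heq i).filter_mono rightHalfPlanes_le_cobounded)⟩

/-! ### The solution set of the tracking equation -/

section Tracking

variable {q p m : ℕ} {hqp : q ≤ p} {T : ℝ} {G₁ : Matrix (Fin q) (Fin p) (RatFunc ℝ)}
  {G₂ : Matrix (Fin q) (Fin m) (RatFunc ℝ)} {D : Fin m → RatFunc ℝ}

theorem inputFormula_eq (y : ℝ → Fin q → ℝ) (u₂ : ℝ → Fin (p - q) → ℝ) (s : ℂ) :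
    inputFormula hqp G₁ G₂ D y u₂ s =
      stack hqp ((evalMat (leftBlock hqp G₁)⁻¹ s).mulVec
          (laplaceVec y s - (evalMat G₂ s).mulVec (evalVec D s)) +
        (evalMat (-((leftBlock hqp G₁)⁻¹ * rightBlock hqp G₁)) s).mulVec (laplaceVec u₂ s))
        (laplaceVec u₂ s) := by
  rw [inputFormula, stack_add_stack, zero_add]

theorem eventually_mulVec_inputFormula (hdet : IsUnit (leftBlock hqp G₁).det) :
    ∀ᶠ s in rightHalfPlanes, ∀ (y : ℝ → Fin q → ℝ) (U : Fin p → ℂ) (u₂ : ℝ → Fin (p - q) → ℝ),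
      (fun j => U (lowerIndex hqp j)) = laplaceVec u₂ s →
      ((evalMat G₁ s).mulVec U = laplaceVec y s - (evalMat G₂ s).mulVec (evalVec D s) ↔
        U = inputFormula hqp G₁ G₂ D y u₂ s) := by
  filter_upwards [eventually_mulVec_stack_eq_iff hqp hdet] with s hs y U u₂ hU
  have h1 : U = stack hqp (fun i => U (Fin.castLE hqp i)) (laplaceVec u₂ s) :=
    (eq_stack_iff hqp).2 ⟨rfl, hU⟩
  rw [inputFormula_eq, eq_stack_iff, and_iff_left hU, ← hs, ← h1]

/-- The point is that the formula yields the transform of an actual signal for every free block.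
Relative to a known solution only the proper matrix `-G₁₁⁻¹ G₁₂` acts, on the difference of the
lower blocks, so nothing has to be differentiated. -/
theorem desiredInputTransforms_eq (hdet : IsUnit (leftBlock hqp G₁).det)
    {H₀ : Matrix (Fin q) (Fin (p - q)) ℝ}
    (hH : LimitAtInfinity (-((leftBlock hqp G₁)⁻¹ * rightBlock hqp G₁)) H₀)
    {y : ℝ → Fin q → ℝ} (hy : ∃ ud, IsDesiredInput G₁ G₂ D y ud) :
    desiredInputTransforms G₁ G₂ D y =
      {U | ∃ ud₂ : ℝ → Fin (p - q) → ℝ, LaplaceTransformableVec ud₂ ∧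
        U =ᶠ[rightHalfPlanes] inputFormula hqp G₁ G₂ D y ud₂} := by
  ext U
  constructor
  · rintro ⟨⟨u, hu, hU⟩, hsol⟩
    refine ⟨fun t j => u t (lowerIndex hqp j), fun j => hu _, ?_⟩
    filter_upwards [hU, hsol, eventually_mulVec_inputFormula (G₂ := G₂) (D := D) hdet] with s h1 h2 h3
    refine (h3 y (U s) _ ?_).1 h2
    rw [h1]
    rfl
  · rintro ⟨ud₂, hud₂, hU⟩
    obtain ⟨u₀, hu₀, hsol₀⟩ := hy
    obtain ⟨κ, -, hop⟩ := hH.exists_convOp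
    have hlow : HasLaplaceVec (fun t j => u₀ t (lowerIndex hqp j))
        (laplaceVec fun t j => u₀ t (lowerIndex hqp j)) :=
      LaplaceTransformableVec.hasLaplaceVec fun j => hu₀ _
    have hup : HasLaplaceVec (fun t i => u₀ t (Fin.castLE hqp i))
        (laplaceVec fun t i => u₀ t (Fin.castLE hqp i)) :=
      LaplaceTransformableVec.hasLaplaceVec fun j => hu₀ _
    have hv := (hup.add (hop _ _ (hud₂.hasLaplaceVec.sub hlow))).stack hqp hud₂.hasLaplaceVec
    have heq : (fun s => stack hqp ((laplaceVec (fun t i => u₀ t (Fin.castLE hqp i)) +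
        fun s => (evalMat (-((leftBlock hqp G₁)⁻¹ * rightBlock hqp G₁)) s).mulVec
          ((laplaceVec ud₂ - laplaceVec fun t j => u₀ t (lowerIndex hqp j)) s)) s)
        (laplaceVec ud₂ s)) =ᶠ[rightHalfPlanes] U := by
      filter_upwards [hU, hsol₀, eventually_mulVec_inputFormula (G₂ := G₂) (D := D) hdet]
        with s h1 h2 h3
      have h4 := (h3 y (laplaceVec u₀ s) (fun t j => u₀ t (lowerIndex hqp j)) rfl).1 h2
      rw [inputFormula_eq, eq_stack_iff] at h4
      have h5 : laplaceVec (fun t i => u₀ t (Fin.castLE hqp i)) s = _ := h4.1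
      rw [h1, inputFormula_eq, Pi.add_apply, h5]
      congr 1
      rw [add_assoc, ← Matrix.mulVec_add]
      simp
    refine ⟨⟨_, (hasLaplaceVec_iff.1 hv).1, ?_⟩, ?_⟩
    · filter_upwards [heq, (hasLaplaceVec_iff.1 hv).2] with s h1 h2
      rw [h2, ← h1]
    · filter_upwards [hU, eventually_mulVec_inputFormula (G₂ := G₂) (D := D) hdet] with s h1 h2
      refine (h2 y (U s) ud₂ ?_).2 h1
      rw [h1, inputFormula_eq]
      exact funext fun j => stack_lowerIndex hqp _ _ j

end Tracking

end ILC

/-! ### The main theorem -/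

theorem theorem2 {q p m : ℕ} (hqp : q ≤ p) (T : ℝ) (hT : 0 < T)
    (G₁ : Matrix (Fin q) (Fin p) (RatFunc ℝ)) (G₂ : Matrix (Fin q) (Fin m) (RatFunc ℝ))
    (D : Fin m → RatFunc ℝ)
    -- C1)
    (hG₁ : StrictlyProper G₁) (hG₂ : StrictlyProper G₂)
    -- C2)
    (d₀ : Fin m → ℝ) (hd₀ : d₀ ≠ 0) (Dhat : Fin m → RatFunc ℝ) (hDhat : StrictlyProperVec Dhat)
    (hD : D = fun i => RatFunc.C (d₀ i) + Dhat i)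
    -- C3)
    (hrel : RelativeDegreeOne G₁)
    -- C4)
    (Φ₁ : ℝ → Matrix (Fin q) (Fin p) ℝ) (hΦ₁ : IsInverseLaplace Φ₁ G₁)
    (hC4 : IsUnit (leftBlock hqp (Φ₁ 0)).det)
    -- the inputs and the outputs of the system along the iterations
    (u : ℕ → ℝ → Fin p → ℝ) (y : ℕ → ℝ → Fin q → ℝ)
    (hrun : ∀ k, IsSystemRun T G₁ G₂ D (u k) (y k))
    -- the specified trajectory
    (yd : ℝ → Fin q → ℝ) (hyd : ContDiffOn ℝ 1 yd (Icc 0 T)) :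
    (Trackable T G₁ G₂ D yd ↔ ∀ k, yd 0 = y k 0) ∧
    (∀ yc, IsRegularContinuation T yd yc →
      ((∃ ud, IsDesiredInput G₁ G₂ D yc ud) ↔ ∀ k, yd 0 = y k 0)) ∧
    IsUnit (leftBlock hqp G₁).det ∧
    (∀ yc, IsContinuation T yd yc → (∃ ud, IsDesiredInput G₁ G₂ D yc ud) →
      desiredInputTransforms G₁ G₂ D yc =
        {U | ∃ ud₂ : ℝ → Fin (p - q) → ℝ, LaplaceTransformableVec ud₂ ∧
          U =ᶠ[rightHalfPlanes] inputFormula hqp G₁ G₂ D yc ud₂}) ∧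
    (∀ yc, IsContinuation T yd yc →
      ∀ (ud : ℝ → Fin p → ℝ) (ud₂ : ℝ → Fin (p - q) → ℝ),
        LaplaceTransformableVec ud → LaplaceTransformableVec ud₂ →
        laplaceVec ud =ᶠ[rightHalfPlanes] inputFormula hqp G₁ G₂ D yc ud₂ →
        (IsContinuousSignal T ud ↔ IsContinuousSignal T ud₂)) := by
  have h0T : (0 : ℝ) ∈ Icc 0 T := left_mem_Icc.2 hT.le
  have hXG := limitAtInfinity_X_smul_of_isInverseLaplace hG₁ hΦ₁
  have hXA : LimitAtInfinity ((RatFunc.X : RatFunc ℝ) • leftBlock hqp G₁)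
      (leftBlock hqp (Φ₁ 0)) :=
    limitAtInfinity_iff.2 fun i j => limitAtInfinity_iff.1 hXG i (Fin.castLE hqp j)
  have hXB : LimitAtInfinity ((RatFunc.X : RatFunc ℝ) • rightBlock hqp G₁)
      (rightBlock hqp (Φ₁ 0)) :=
    limitAtInfinity_iff.2 fun i j => limitAtInfinity_iff.1 hXG i (lowerIndex hqp j)
  have hdetX := hXA.isUnit_det hC4
  have hdet : IsUnit (leftBlock hqp G₁).det := isUnit_det_of_X_smul hdetX
  have hG₁' : LimitAtInfinity G₁ 0 :=
    limitAtInfinity_iff.2 fun i j => by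
      rw [Matrix.zero_apply, Complex.ofReal_zero]
      exact tendsto_pi_nhds.1 (tendsto_pi_nhds.1 hG₁ i) j
  -- The factors `s` cancel in `(s G₁₁)⁻¹ (s G₁₂)`, a product of two matrices with finite limits.
  have hH : LimitAtInfinity (-((leftBlock hqp G₁)⁻¹ * rightBlock hqp G₁))
      (-((leftBlock hqp (Φ₁ 0))⁻¹ * rightBlock hqp (Φ₁ 0))) := by
    have h := ((hXA.inv hC4).mul hXB).neg
    have hX : (RatFunc.X : RatFunc ℝ) • rightBlock hqp G₁ =
        ((RatFunc.X : RatFunc ℝ) • leftBlock hqp G₁) *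
          ((leftBlock hqp G₁)⁻¹ * rightBlock hqp G₁) := by
      rw [Matrix.smul_mul, Matrix.mul_nonsing_inv_cancel_left _ _ hdet]
    rwa [hX, Matrix.nonsing_inv_mul_cancel_left _ _ hdetX] at h
  set Ψ : Fin q → RatFunc ℝ := G₂.mulVec D with hΨ
  obtain ⟨ψ, χ, hψc, hχc, hψ, hχ⟩ := exists_inverseLaplaceVec (Ψ := Ψ) fun i =>
    tendsto_evalC_mulVec_of_strictlyProper hG₂ (hD ▸ tendsto_evalVec_const_add hDhat) i
  have hΨs : ∀ᶠ s in rightHalfPlanes, evalVec Ψ s = (evalMat G₂ s).mulVec (evalVec D s) :=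
    (eventually_evalVec_mulVec G₂ D).filter_mono rightHalfPlanes_le_cobounded
  have hrun0 : ∀ u' y', IsSystemRun T G₁ G₂ D u' y' → y' 0 = ψ 0 := by
    rintro u' y' ⟨hu', hy', hyc', hsys⟩
    refine hG₁'.output_zero hT hψc hψ hu'.hasLaplaceVec (hy'.hasLaplaceVec.congr ?_) hyc'
    filter_upwards [hsys, hΨs] with s h1 h2
    rw [h1, h2]
  have hcond : (∀ k, yd 0 = y k 0) ↔ yd 0 = ψ 0 :=
    ⟨fun h => (h 0).trans (hrun0 _ _ (hrun 0)), fun h k => h.trans (hrun0 _ _ (hrun k)).symm⟩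
  rw [hcond]
  -- A solution makes `(ud, yc)` itself a run of the system, so `yc` starts at `ψ 0`.
  have hnec : ∀ yc, IsContinuation T yd yc → ∀ ud, IsDesiredInput G₁ G₂ D yc ud →
      yd 0 = ψ 0 := by
    rintro yc ⟨hyc, hEq⟩ ud ⟨hud, hsol⟩
    rw [← hEq h0T]
    refine hrun0 ud yc ⟨hud, hyc, hyd.continuousOn.congr hEq, ?_⟩
    filter_upwards [hsol] with s hs
    rw [hs, sub_add_cancel]
  have hreg : ∀ yc, IsRegularContinuation T yd yc → yd 0 = ψ 0 →
      ∃ w, HasLaplaceVec w (fun s => (evalMat (leftBlock hqp G₁)⁻¹ s).mulVec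
        (laplaceVec yc s - (evalMat G₂ s).mulVec (evalVec D s))) ∧ ContinuousOn w (Icc 0 T) := by
    rintro yc ⟨⟨hyc, hEq⟩, hC1, hder⟩ h0
    have h1 : yc 0 = ψ 0 := (hEq h0T).trans h0
    have h2 := (hasLaplaceVec_derivWithin hC1 hyc.hasLaplaceVec hder).sub hχ
    refine hXA.exists_inverse_signal hC4 (h2.congr ?_) ?_
    · filter_upwards [hΨs] with s hs
      funext i
      rw [← hs, h1]
      simp only [Pi.sub_apply, Pi.smul_apply, smul_eq_mul]
      ring
    · exact ((hC1.continuousOn_derivWithin (uniqueDiffOn_Ici 0) le_rfl).mono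
        Icc_subset_Ici_self).sub hχc.continuousOn
  have hsuff : ∀ yc, IsRegularContinuation T yd yc → yd 0 = ψ 0 →
      ∃ ud, IsDesiredInput G₁ G₂ D yc ud := by
    intro yc hyc h0
    obtain ⟨w, hw, -⟩ := hreg yc hyc h0
    -- The solution with free block zero suffices for existence.
    have hz : HasLaplaceVec (0 : ℝ → Fin (p - q) → ℝ) 0 := fun i => hasLaplace_zero
    have hud := hasLaplaceVec_iff.1 (hw.stack hqp hz)
    refine ⟨_, hud.1, ?_⟩
    filter_upwards [hud.2, eventually_mulVec_stack_eq_iff hqp hdet] with s h1 h2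
    rw [h1, h2]
    simp
  refine ⟨⟨fun ⟨yc, hyc, ud, hud⟩ => hnec yc hyc ud hud, fun h0 => ?_⟩,
    fun yc hyc => ⟨fun ⟨ud, hud⟩ => hnec yc hyc.1 ud hud, hsuff yc hyc⟩, hdet,
    fun yc _ hsol => desiredInputTransforms_eq hdet hH hsol, ?_⟩
  · obtain ⟨yc, hyc⟩ := exists_isRegularContinuation hT hyd
    exact ⟨yc, hyc.1, hsuff yc hyc h0⟩
  intro yc hyc ud ud₂ hud hud₂ hform
  have hlowae : (fun t j => ud t (lowerIndex hqp j)) =ᵐ[volume.restrict (Icc 0 T)] ud₂ := by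
    have h1 : HasLaplaceVec (fun t j => ud t (lowerIndex hqp j)) (laplaceVec ud₂) := by
      refine (LaplaceTransformableVec.hasLaplaceVec fun j => hud _).congr ?_
      filter_upwards [hform] with s hs
      rw [inputFormula_eq, eq_stack_iff] at hs
      exact hs.2
    exact ae_restrict_Icc_of_Ioi (h1.ae_eq hud₂.hasLaplaceVec)
  refine ⟨fun h => (h.comp_index (lowerIndex hqp)).congr_ae hlowae, fun h => ?_⟩
  have hdes : IsDesiredInput G₁ G₂ D yc ud := by
    refine ⟨hud, ?_⟩
    filter_upwards [hform, eventually_mulVec_inputFormula (G₂ := G₂) (D := D) hdet] with s h1 h2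
    refine (h2 yc (laplaceVec ud s) ud₂ ?_).2 h1
    rw [inputFormula_eq, eq_stack_iff] at h1
    exact h1.2
  -- The given `yc` may be irregular beyond `T`; it is compared with a regular continuation, whose
  -- `wr` is continuous on `[0, T]`.
  obtain ⟨yr, hyr⟩ := exists_isRegularContinuation hT hyd
  obtain ⟨wr, hwr, hwrc⟩ := hreg yr hyr (hnec yc hyc ud hdes)
  obtain ⟨κ, hκ, hop⟩ := hH.exists_convOp
  -- Removing the contribution of `ud₂` from the upper block leaves a signal with transform `G₁₁⁻¹
  -- (Y - G₂ D)`.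
  set w : ℝ → Fin q → ℝ := (fun t i => ud t (Fin.castLE hqp i)) -
    convOp (-((leftBlock hqp (Φ₁ 0))⁻¹ * rightBlock hqp (Φ₁ 0))) κ ud₂ with hw
  have hwL : HasLaplaceVec w (fun s => (evalMat (leftBlock hqp G₁)⁻¹ s).mulVec
      (laplaceVec yc s - (evalMat G₂ s).mulVec (evalVec D s))) := by
    refine ((LaplaceTransformableVec.hasLaplaceVec
      (u := fun t i => ud t (Fin.castLE hqp i)) fun i => hud _).sub
        (hop _ _ hud₂.hasLaplaceVec)).congr ?_
    filter_upwards [hform] with s hs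
    rw [inputFormula_eq, eq_stack_iff] at hs
    have h5 : laplaceVec (fun t i => ud t (Fin.castLE hqp i)) s = _ := hs.1
    rw [Pi.sub_apply, h5, add_sub_cancel_right]
  -- The disturbance cancels in the difference, and `yc - yr` vanishes on `[0, T]`, so causality of
  -- the inverse applies.
  have hdiff : w - wr =ᵐ[volume.restrict (Icc 0 T)] 0 := by
    refine hXA.inverse_ae_eq_zero hC4 hT (g := yc - yr)
      (hyc.1.hasLaplaceVec.sub hyr.1.1.hasLaplaceVec) ((hwL.sub hwr).congr ?_) ?_
    · refine Eventually.of_forall fun s => ?_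
      simp only [Pi.sub_apply]
      rw [← Matrix.mulVec_sub, sub_sub_sub_cancel_right]
    · filter_upwards [ae_restrict_mem measurableSet_Icc] with t ht
      rw [Pi.sub_apply, hyc.2 ht, hyr.1.2 ht, sub_self]
      rfl
  have hwc : IsContinuousSignal T w := by
    refine ⟨wr, hwrc, ?_⟩
    filter_upwards [hdiff] with t ht
    exact sub_eq_zero.1 ht
  refine isContinuousSignal_of_blocks hqp ?_ (h.congr_ae hlowae.symm)
  have h6 := hwc.add (h.convOp (A₀ := -((leftBlock hqp (Φ₁ 0))⁻¹ * rightBlock hqp (Φ₁ 0))) hκ)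
  rwa [hw, sub_add_cancel] at h6
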